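/- **Setting.** A buyer has a value $v\ge 0$ drawn from a distribution $D$ on $[0,\infty)$ with density $f$ and CDF $F$. Let $\Gamma_D(z)=z(1-F(z))$ and let $\varphi_D(v)=v-\frac{1-F(v)}{f(v)}$ (with value $-\infty$ where $f(v)=0$ and $F(v)<1$). $D$ is *regular* if $\varphi_D$ is non-decreasing on $\{v\ge 0: F(v)<1\}$, and *DMR* if $\varphi_D(v)f(v)=vf(v)-(1-F(v))$ is non-decreasing on $\{v\ge 0:F(v)<1\}$. A *mechanism* is a pricing function $M:[0,1]\to[0,\infty]$ with $M(0)=0$ that is non-decreasing, and continuous and convex on $[0,\bar x]$, where $\bar x=\sup\{x: M(x)<\infty\}$; the buyer may choose any $x$ with $M(x)<\infty$, pays $M(x)$ and gets the good with probability $x$. The *lottery with price $p$ and probability $z$* is $M(x)=px$ for $x\le z$, $M(x)=\infty$ for $x>z$. $\mathrm{Rev}(D)$ is the supremum, over mechanisms $M$, of the expected payment of a utility-maximizing buyer who faces only $M$. Two sellers, Alice and Bob, each sell a copy of the same good by mechanisms $A$ and $B$. The buyer wants one copy. Knowing $v,A,B$, the buyer chooses which seller to visit first, an option $a$ of $A$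 and an option $b$ of $B$; the option of the second seller is bought only if the first one did not deliver the good. With Bob first, the expected utility is $bv-B(b)+(1-b)(av-A(a))$; with Alice first, it is $av-A(a)+(1-a)(bv-B(b))$. The buyer maximizes expected utility, breaks ties first in favor of the larger expected allocation from Bob, then in favor of the larger expected allocation from Alice; if a tie remains, an arbitrary fixed rule decides. Let $\mathsf{rev}_{\mathsf A,(A,B)}(D)$ and $\mathsf{rev}_{\mathsf B,(A,B)}(D)$ be the resulting expected payments to Alice and to Bob. $B$ is a *best response* to $A$ if it maximizes $\mathsf{rev}_{\mathsf B,(A,\cdot)}(D)$ over all mechanisms. A mechanism $A$ and a map $\mathbb M$ from mechanisms to mechanisms form a *Stackelberg equilibrium* if $\mathbb M(A')$ is a best response to $A'$ for every $A'$, and $A$ maximizes $A'\mapsto \mathsf{rev}_{\mathsf A,(A',\mathbb M(A'))}(D)$. **Theorem.** Let $D$ be regular or DMR, and let $\mathtt v\ge 0$ be a maximizer of $\Gamma_D$ on $[0,\infty)$ (a Myerson price; its existence is assumed). Then $\mathrm{Rev}(D)=\Gamma_D(\mathtt v)$. There is a smallest $p\in[0,\mathtt v]$ with $\Gamma_D(p)=\Gamma_D(\mathtt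 v)/2$, and it has the following properties. 1. If $A$ is the lottery with price $p$ and probability $1/2$, then Bob has a best response $B$ to $A$ with $$\mathsf{rev}_{\mathsf A,(A,B)}(D)\ge \tfrac14\Gamma_D(\mathtt v)\quad\text{and}\quad \mathsf{rev}_{\mathsf B,(A,B)}(D)\ge\tfrac12\Gamma_D(\mathtt v).$$ 2. For every $\varepsilon>0$ there is $\delta>0$ such that for every $p'\ge 0$ with $p-\delta<p'<p$, if $A'$ is the lottery with price $p'$ and probability $1/2$, then Bob has a best response to $A'$, and every best response $B$ of Bob to $A'$ satisfies $$\mathsf{rev}_{\mathsf A,(A',B)}(D)\ge \tfrac14\Gamma_D(\mathtt v)-\varepsilon\quad\text{and}\quad \mathsf{rev}_{\mathsf B,(A',B)}(D)\ge\tfrac12\Gamma_D(\mathtt v)-\varepsilon.$$ Consequently the supremum of $\mathsf{rev}_{\mathsf A,(A,B)}(D)$ over all mechanisms $A$ and all best responses $B$ to $A$ is at least $\mathrm{Rev}(D)/4$, and in every Stackelberg equilibrium $(A,\mathbb M)$ Alice's revenue $\mathsf{rev}_{\mathsf A,(A,\mathbb M(A))}(D)$ is at least $\mathrm{Rev}(D)/4$.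 -/

import Mathlib

open MeasureTheory ProbabilityTheory Set Filter Topology
open scoped NNReal ENNReal

noncomputable section

/-! ### The value distribution -/

/-- `f` is a (real-valued, nonnegative, measurable) density of `D`. -/
def IsDensity (D : Measure ℝ) (f : ℝ → ℝ) : Prop :=
  Measurable f ∧ (∀ v, 0 ≤ f v) ∧ D = volume.withDensity (fun v => ENNReal.ofReal (f v))

/-- The revenue curve `Γ_D(z) = z (1 - F(z))`. -/
def revenueCurve (D : Measure ℝ) (z : ℝ) : ℝ := z * (1 - cdf D z)

/-- The set of nonnegative values that are not yet beyond the top of the distribution. It includes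
the values below the support. -/
def valueRange (D : Measure ℝ) : Set ℝ := {v | 0 ≤ v ∧ cdf D v < 1}

/-- The virtual value `v - (1 - F(v)) / f(v)`. On `valueRange D` the numerator is positive, so that
the virtual value is `-∞` where the density vanishes. -/
def virtualValue (D : Measure ℝ) (f : ℝ → ℝ) (v : ℝ) : EReal :=
  if f v = 0 then ⊥ else ((v - (1 - cdf D v) / f v : ℝ) : EReal)

/-- Regularity: the virtual value is non-decreasing. -/
def IsRegularDist (D : Measure ℝ) (f : ℝ → ℝ) : Prop :=
  MonotoneOn (virtualValue D f) (valueRange D)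

/-- Diminishing marginal revenue: virtual value times density, that is
`v f(v) - (1 - F(v))`, is non-decreasing. -/
def IsDMRDist (D : Measure ℝ) (f : ℝ → ℝ) : Prop :=
  MonotoneOn (fun v => v * f v - (1 - cdf D v)) (valueRange D)

/-! ### Mechanisms as proper pricing functions -/

/-- The largest probability offered at a finite price. -/
def maxProb (M : ℝ → ℝ≥0∞) : ℝ := sSup {x | x ∈ Icc (0 : ℝ) 1 ∧ M x < ⊤}

/-- A mechanism: a proper pricing function on `[0, 1]` with values in `[0, ∞]`. The values of
`price` outside `[0, 1]` are never used. -/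
structure Mechanism where
  price : ℝ → ℝ≥0∞
  price_zero : price 0 = 0
  monotoneOn : MonotoneOn price (Icc 0 1)
  continuousOn : ContinuousOn price (Icc 0 (maxProb price))
  convexOn : ConvexOn ℝ≥0 (Icc 0 (maxProb price)) price

/-- The pricing function of a single lottery: `x ↦ p x` on `[0, z]` and `∞` beyond `z`. -/
def lotteryPrice (p : ℝ≥0) (z : ℝ) (x : ℝ) : ℝ≥0∞ :=
  if x ≤ z then p * ENNReal.ofReal x else ⊤

theorem maxProb_lotteryPrice (p : ℝ≥0) (z : ℝ) (hz : z ∈ Icc (0 : ℝ) 1) :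
    maxProb (lotteryPrice p z) = z := by
  have h : {x | x ∈ Icc (0 : ℝ) 1 ∧ lotteryPrice p z x < ⊤} = Icc 0 z := by
    ext x
    simp only [lotteryPrice, mem_ofPred_eq, mem_Icc]
    constructor
    · rintro ⟨⟨h0, _⟩, h⟩
      refine ⟨h0, ?_⟩
      by_contra hx
      simp [hx] at h
    · rintro ⟨h0, hx⟩
      exact ⟨⟨h0, hx.trans hz.2⟩, by simp [hx, ENNReal.mul_lt_top]⟩
  rw [maxProb, h, csSup_Icc hz.1]

/-- The single-lottery mechanism with price `p` and probability `z`: a buyer who takes the lottery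
pays `p z` in expectation. -/
def lottery (p : ℝ≥0) (z : ℝ) (hz : z ∈ Icc (0 : ℝ) 1) : Mechanism where
  price := lotteryPrice p z
  price_zero := by simp [lotteryPrice, hz.1]
  monotoneOn := by
    intro x _ y _ hxy
    by_cases hy : y ≤ z
    · have hx : x ≤ z := hxy.trans hy
      simp only [lotteryPrice, hx, hy, if_true]
      gcongr
    · simp [lotteryPrice, hy]
  continuousOn := by
    rw [maxProb_lotteryPrice p z hz]
    have h : ContinuousOn (fun x : ℝ => (p : ℝ≥0∞) * ENNReal.ofReal x) (Icc 0 z) :=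
      ((ENNReal.continuous_const_mul ENNReal.coe_ne_top).comp
        ENNReal.continuous_ofReal).continuousOn
    refine h.congr ?_
    intro x hx
    simp [lotteryPrice, hx.2]
  convexOn := by
    rw [maxProb_lotteryPrice p z hz]
    have hconv : ∀ ⦃x⦄, x ∈ Icc (0 : ℝ) z → ∀ ⦃y⦄, y ∈ Icc (0 : ℝ) z → ∀ ⦃a b : ℝ≥0⦄,
        a + b = 1 → a • x + b • y ∈ Icc (0 : ℝ) z := by
      intro x hx y hy a b hab
      have hab' : (a : ℝ) + b = 1 := by exact_mod_cast hab
      simp only [NNReal.smul_def, smul_eq_mul, mem_Icc]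
      constructor
      · have h1 := mul_nonneg a.2 hx.1
        have h2 := mul_nonneg b.2 hy.1
        exact add_nonneg h1 h2
      · have h1 := mul_le_mul_of_nonneg_left hx.2 a.2
        have h2 := mul_le_mul_of_nonneg_left hy.2 b.2
        calc (a : ℝ) * x + b * y ≤ a * z + b * z := add_le_add h1 h2
          _ = z := by rw [← add_mul, hab', one_mul]
    refine ⟨fun x hx y hy a b _ _ hab => hconv hx hy hab, ?_⟩
    intro x hx y hy a b _ _ hab
    have hm := hconv hx hy hab
    simp only [lotteryPrice, hx.2, hy.2, hm.2, if_true]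
    simp only [NNReal.smul_def, smul_eq_mul, ENNReal.smul_def]
    rw [ENNReal.ofReal_add (mul_nonneg a.coe_nonneg hx.1) (mul_nonneg b.coe_nonneg hy.1),
      ENNReal.ofReal_mul a.coe_nonneg, ENNReal.ofReal_mul b.coe_nonneg,
      ENNReal.ofReal_coe_nnreal, ENNReal.ofReal_coe_nnreal]
    apply le_of_eq
    ring

/-! ### The monopolist -/

/-- `x` maximizes the utility of a buyer of value `v` who faces only the mechanism `M`. -/
def IsMonopolyChoice (M : Mechanism) (v x : ℝ) : Prop :=
  x ∈ Icc (0 : ℝ) 1 ∧ M.price x ≠ ⊤ ∧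
    ∀ y ∈ Icc (0 : ℝ) 1, M.price y ≠ ⊤ →
      v * y - (M.price y).toReal ≤ v * x - (M.price x).toReal

/-- `Rev(D)`: the optimal expected revenue of a single seller. -/
def monopolyRev (D : Measure ℝ) : ℝ≥0∞ :=
  sSup {r | ∃ (M : Mechanism) (x : ℝ → ℝ), (∀ v, 0 ≤ v → IsMonopolyChoice M v (x v)) ∧
    r = ∫⁻ v, M.price (x v) ∂D}

/-! ### The buyer in the duopoly -/

/-- A strategy of the buyer: the seller to be visited first, the probability `a` bought from Alice
and the probability `b` bought from Bob. The purchase from the seller visited second takes place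
only if the first seller did not allocate the good. -/
structure BuyerPlan where
  bobFirst : Bool
  a : ℝ
  b : ℝ

namespace BuyerPlan

def Feasible (A B : Mechanism) (s : BuyerPlan) : Prop :=
  s.a ∈ Icc (0 : ℝ) 1 ∧ s.b ∈ Icc (0 : ℝ) 1 ∧ A.price s.a ≠ ⊤ ∧ B.price s.b ≠ ⊤

/-- The probability that Alice is visited and the purchase at her shop takes place. -/
def reachA (s : BuyerPlan) : ℝ := if s.bobFirst then 1 - s.b else 1

/-- The probability that Bob is visited and the purchase at his shop takes place. -/
def reachB (s : BuyerPlan) : ℝ := if s.bobFirst then 1 else 1 - s.a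

/-- Expected allocation from Alice. -/
def allocA (s : BuyerPlan) : ℝ := s.reachA * s.a

/-- Expected allocation from Bob. -/
def allocB (s : BuyerPlan) : ℝ := s.reachB * s.b

/-- Expected payment to Alice. -/
def payA (A : Mechanism) (s : BuyerPlan) : ℝ := s.reachA * (A.price s.a).toReal

/-- Expected payment to Bob. -/
def payB (B : Mechanism) (s : BuyerPlan) : ℝ := s.reachB * (B.price s.b).toReal

/-- Expected utility of a buyer of value `v`. -/
def utility (A B : Mechanism) (v : ℝ) (s : BuyerPlan) : ℝ :=
  v * (s.allocA + s.allocB) - s.payA A - s.payB B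

/-- `s` maximizes the expected utility; ties are broken first in favor of the larger expected
allocation from Bob, then in favor of the larger expected allocation from Alice. -/
def Optimal (A B : Mechanism) (v : ℝ) (s : BuyerPlan) : Prop :=
  s.Feasible A B ∧ ∀ t : BuyerPlan, t.Feasible A B →
    t.utility A B v < s.utility A B v ∨
      (t.utility A B v = s.utility A B v ∧
        (t.allocB < s.allocB ∨ (t.allocB = s.allocB ∧ t.allocA ≤ s.allocA)))

end BuyerPlan

/-- The buyer's behavior for all pairs of mechanisms (Alice's first) and all values. -/
abbrev BuyerRule := Mechanism → Mechanism → ℝ → BuyerPlan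

/-- The buyer always plays optimally, with the above tie-breaking. -/
def BuyerRule.IsOptimal (σ : BuyerRule) : Prop :=
  ∀ (A B : Mechanism) (v : ℝ), 0 ≤ v → (σ A B v).Optimal A B v

/-! ### The sellers in the duopoly -/

/-- Alice's expected revenue. -/
def revA (σ : BuyerRule) (D : Measure ℝ) (A B : Mechanism) : ℝ≥0∞ :=
  ∫⁻ v, ENNReal.ofReal ((σ A B v).payA A) ∂D

/-- Bob's expected revenue. -/
def revB (σ : BuyerRule) (D : Measure ℝ) (A B : Mechanism) : ℝ≥0∞ :=
  ∫⁻ v, ENNReal.ofReal ((σ A B v).payB B) ∂D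

/-- `B` is a best response of Bob to Alice's mechanism `A`. -/
def IsBestResponse (σ : BuyerRule) (D : Measure ℝ) (A B : Mechanism) : Prop :=
  ∀ B' : Mechanism, revB σ D A B' ≤ revB σ D A B

/-- Alice's mechanism `A` and Bob's strategy `R` (a map from Alice's mechanism to a mechanism of
Bob) form a Stackelberg equilibrium. -/
def IsStackelbergEquilibrium (σ : BuyerRule) (D : Measure ℝ) (A : Mechanism)
    (R : Mechanism → Mechanism) : Prop :=
  (∀ A' : Mechanism, IsBestResponse σ D A' (R A')) ∧
    ∀ A' : Mechanism, revA σ D A' (R A') ≤ revA σ D A (R A)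

/-- Alice's best Stackelberg revenue: the supremum of her revenue over her mechanisms and the best
responses of Bob. -/
def stackelbergRev (σ : BuyerRule) (D : Measure ℝ) : ℝ≥0∞ :=
  ⨆ (A : Mechanism) (B : Mechanism) (_ : IsBestResponse σ D A B), revA σ D A B

end

/-!
A mechanism is a random posted price: its largest utility-maximizing option is the distribution
function of a price `s`. Against Alice's lottery at price `p` with probability `z`, a buyer of value
`w` who visits Bob first acts there like a buyer of value `w - z (w - p)⁺`, and whom a buyer above
`p` visits first is decided by the expectation of a tent function of `s`, which is monotone in `w`.
So the buyers up to some threshold visit Bob first, and the remaining ones visit Alice first.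

Up to the Myerson price `v`, the marginal revenue of a regular or DMR distribution is antitone, so
that the revenue curve is concave there. For a single posted price `s`, its supergradient at `p`
bounds Bob's revenue by `(1 - z) Γ(v)` minus a multiple of the tent function, whose expectation
vanishes at the threshold. Averaging over `s` shows that `v` is a best response to every lottery
with `Γ(p) ≤ (1 - z) Γ(v)`, and that, if the inequality is strict, a best response makes no sale to
a buyer above `p` before Alice's lottery is drawn, so that Alice earns `z Γ(p)`.
-/

section Subgradient

variable {x U : ℝ → ℝ}

theorem monotone_of_subgradient (h : ∀ w w', U w + x w * (w' - w) ≤ U w') : Monotone x := by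
  intro a b hab
  rcases hab.eq_or_lt with rfl | hlt
  · exact le_rfl
  · have hab := h a b
    have hba := h b a
    exact le_of_mul_le_mul_right (by linarith : x a * (b - a) ≤ x b * (b - a)) (sub_pos.2 hlt)

theorem lipschitzWith_of_subgradient (h : ∀ w w', U w + x w * (w' - w) ≤ U w')
    (hx : ∀ w, x w ∈ Icc (0 : ℝ) 1) : LipschitzWith 1 U := by
  refine LipschitzWith.of_le_add fun a b => ?_
  have hslope : x a * (a - b) ≤ |a - b| := by
    calc x a * (a - b) ≤ x a * |a - b| := mul_le_mul_of_nonneg_left (le_abs_self _) (hx a).1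
      _ ≤ |a - b| := mul_le_of_le_one_left (abs_nonneg _) (hx a).2
  rw [Real.dist_eq]
  linarith [h a b]

theorem hasDerivAt_of_subgradient (h : ∀ w w', U w + x w * (w' - w) ≤ U w') {w : ℝ}
    (hw : ContinuousAt x w) : HasDerivAt U (x w) w := by
  rw [hasDerivAt_iff_isLittleO, Asymptotics.isLittleO_iff]
  intro c hc
  filter_upwards [Metric.continuousAt_iff'.1 hw c hc] with y hy
  rw [Real.dist_eq] at hy
  have hwy := h w y
  have hyw := h y w
  rw [smul_eq_mul, Real.norm_eq_abs, Real.norm_eq_abs, abs_of_nonneg (by linarith)]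
  calc U y - U w - (y - w) * x w ≤ (x y - x w) * (y - w) := by linarith
    _ ≤ |x y - x w| * |y - w| := (le_abs_self _).trans (abs_mul _ _).le
    _ ≤ c * |y - w| := mul_le_mul_of_nonneg_right hy.le (abs_nonneg _)

theorem integral_of_subgradient (h : ∀ w w', U w + x w * (w' - w) ≤ U w')
    (hx : ∀ w, x w ∈ Icc (0 : ℝ) 1) (a b : ℝ) : ∫ t in a..b, x t = U b - U a :=
  integral_eq_of_hasDerivAt_off_countable U x
    (monotone_of_subgradient h).countable_not_continuousAt
    (lipschitzWith_of_subgradient h hx).continuous.continuousOn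
    (fun _ ht => hasDerivAt_of_subgradient h (not_not.1 ht.2))
    (monotone_of_subgradient h).intervalIntegrable

end Subgradient

/-! ### A single mechanism as a random posted price -/

namespace Mechanism

variable (M : Mechanism) {w : ℝ}

theorem maxProb_mem : maxProb M.price ∈ Icc (0 : ℝ) 1 := by
  have hbdd : BddAbove {x | x ∈ Icc (0 : ℝ) 1 ∧ M.price x < ⊤} := ⟨1, fun _ hx => hx.1.2⟩
  have hzero : (0 : ℝ) ∈ {x | x ∈ Icc (0 : ℝ) 1 ∧ M.price x < ⊤} := by simp [M.price_zero]
  exact ⟨le_csSup hbdd hzero, csSup_le ⟨0, hzero⟩ fun _ hx => hx.1.2⟩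

variable {M} in
theorem le_maxProb {y : ℝ} (hy : y ∈ Icc (0 : ℝ) 1) (hM : M.price y ≠ ⊤) :
    y ≤ maxProb M.price :=
  le_csSup ⟨1, fun _ hx => hx.1.2⟩ ⟨hy, hM.lt_top⟩

/-- The payment for `y` plus the surplus forgone by not receiving the good with certainty. Buyers
minimize it, and unlike the utility it stays continuous where the price becomes infinite. -/
noncomputable def cost (w y : ℝ) : ℝ≥0∞ := M.price y + ENNReal.ofReal (|w| - w * y)

theorem continuousOn_cost (w : ℝ) : ContinuousOn (M.cost w) (Icc 0 (maxProb M.price)) :=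
  M.continuousOn.add (ENNReal.continuous_ofReal.comp (by fun_prop)).continuousOn

theorem toReal_cost {y : ℝ} (hy : y ∈ Icc (0 : ℝ) 1) (hM : M.price y ≠ ⊤) :
    (M.cost w y).toReal = |w| - (w * y - (M.price y).toReal) := by
  have hwy : w * y ≤ |w| := by
    calc w * y ≤ |w| * y := mul_le_mul_of_nonneg_right (le_abs_self w) hy.1
      _ ≤ |w| := mul_le_of_le_one_right (abs_nonneg w) hy.2
  rw [cost, ENNReal.toReal_add hM ENNReal.ofReal_ne_top, ENNReal.toReal_ofReal (sub_nonneg.2 hwy)]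
  ring

theorem isMonopolyChoice_iff_isMinOn_cost {y : ℝ} : IsMonopolyChoice M w y ↔
    y ∈ Icc 0 (maxProb M.price) ∧ IsMinOn (M.cost w) (Icc 0 (maxProb M.price)) y := by
  have hcost : ∀ u, M.cost w u ≠ ⊤ ↔ M.price u ≠ ⊤ := by simp [cost]
  have hmem : ∀ u ∈ Icc 0 (maxProb M.price), u ∈ Icc (0 : ℝ) 1 :=
    fun u hu => ⟨hu.1, hu.2.trans M.maxProb_mem.2⟩
  constructor
  · rintro ⟨hy, hM, hmax⟩
    refine ⟨⟨hy.1, le_maxProb hy hM⟩, fun u hu => ?_⟩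
    by_cases hu' : M.price u = ⊤
    · simp [cost, hu']
    · rw [mem_ofPred_eq, ← ENNReal.toReal_le_toReal ((hcost y).2 hM) ((hcost u).2 hu'),
        M.toReal_cost hy hM, M.toReal_cost (hmem u hu) hu']
      linarith [hmax u (hmem u hu) hu']
  · rintro ⟨hy, hmin⟩
    have hM : M.price y ≠ ⊤ := by
      refine (hcost y).1 (ne_top_of_le_ne_top ?_ (hmin ⟨le_rfl, M.maxProb_mem.1⟩))
      simp [hcost, M.price_zero]
    refine ⟨hmem y hy, hM, fun u hu hu' => ?_⟩
    have hle := ENNReal.toReal_mono ((hcost u).2 hu') (hmin ⟨hu.1, le_maxProb hu hu'⟩)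
    rw [M.toReal_cost (hmem y hy) hM, M.toReal_cost hu hu'] at hle
    linarith

/-- The largest utility-maximizing option of a buyer of value `w`. A buyer of negative value, who
takes nothing, is admitted as well. -/
noncomputable def demand (w : ℝ) : ℝ := sSup {y | IsMonopolyChoice M w y}

theorem isGreatest_demand (w : ℝ) : IsGreatest {y | IsMonopolyChoice M w y} (M.demand w) := by
  obtain ⟨y, hy, hmin⟩ := isCompact_Icc.exists_isMinOn
    (nonempty_Icc.2 M.maxProb_mem.1) (M.continuousOn_cost w)
  have hclosed : IsClosed {u ∈ Icc 0 (maxProb M.price) | M.cost w u ≤ M.cost w y} :=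
    isClosed_Icc.isClosed_le (M.continuousOn_cost w) continuousOn_const
  have hset : {u | IsMonopolyChoice M w u} =
      {u ∈ Icc 0 (maxProb M.price) | M.cost w u ≤ M.cost w y} := by
    ext u
    simp only [mem_ofPred_eq, isMonopolyChoice_iff_isMinOn_cost]
    exact and_congr_right fun _ =>
      ⟨fun h => h hy, fun h => isMinOn_iff.2 fun t ht => h.trans (hmin ht)⟩
  have hcompact : IsCompact {u | IsMonopolyChoice M w u} :=
    hset ▸ isCompact_Icc.of_isClosed_subset hclosed fun _ hu => hu.1
  exact hcompact.isGreatest_sSup ⟨y, (M.isMonopolyChoice_iff_isMinOn_cost).2 ⟨hy, hmin⟩⟩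

theorem isMonopolyChoice_demand (w : ℝ) : IsMonopolyChoice M w (M.demand w) :=
  (M.isGreatest_demand w).1

theorem demand_mem (w : ℝ) : M.demand w ∈ Icc (0 : ℝ) 1 := (M.isMonopolyChoice_demand w).1

theorem price_demand_ne_top (w : ℝ) : M.price (M.demand w) ≠ ⊤ :=
  (M.isMonopolyChoice_demand w).2.1

/-- The largest utility of a buyer of value `w` who faces only `M`. -/
noncomputable def indirectUtility (w : ℝ) : ℝ :=
  w * M.demand w - (M.price (M.demand w)).toReal

variable {M}

theorem _root_.IsMonopolyChoice.le_demand {y : ℝ} (h : IsMonopolyChoice M w y) :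
    y ≤ M.demand w :=
  (M.isGreatest_demand w).2 h

theorem le_indirectUtility {y : ℝ} (hy : y ∈ Icc (0 : ℝ) 1) (hM : M.price y ≠ ⊤) :
    w * y - (M.price y).toReal ≤ M.indirectUtility w :=
  (M.isMonopolyChoice_demand w).2.2 y hy hM

theorem isMonopolyChoice_of_indirectUtility_le {y : ℝ} (hy : y ∈ Icc (0 : ℝ) 1)
    (hM : M.price y ≠ ⊤) (hle : M.indirectUtility w ≤ w * y - (M.price y).toReal) :
    IsMonopolyChoice M w y :=
  ⟨hy, hM, fun _ hu hu' => (le_indirectUtility hu hu').trans hle⟩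

variable (M)

theorem indirectUtility_subgradient (w w' : ℝ) :
    M.indirectUtility w + M.demand w * (w' - w) ≤ M.indirectUtility w' := by
  have := le_indirectUtility (w := w') (M.demand_mem w) (M.price_demand_ne_top w)
  rw [indirectUtility]
  linarith

theorem monotone_demand : Monotone M.demand :=
  monotone_of_subgradient M.indirectUtility_subgradient

theorem continuous_indirectUtility : Continuous M.indirectUtility :=
  (lipschitzWith_of_subgradient M.indirectUtility_subgradient M.demand_mem).continuous

theorem indirectUtility_nonneg (w : ℝ) : 0 ≤ M.indirectUtility w := by
  simpa [M.price_zero] using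
    le_indirectUtility (M := M) (w := w) (y := 0) (by simp) (by simp [M.price_zero])

theorem demand_of_neg (hw : w < 0) : M.demand w = 0 := by
  by_contra hne
  have hpos : 0 < M.demand w := (M.demand_mem w).1.lt_of_ne' hne
  have := M.indirectUtility_nonneg w
  rw [indirectUtility] at this
  linarith [mul_neg_of_neg_of_pos hw hpos, @ENNReal.toReal_nonneg (M.price (M.demand w))]

theorem indirectUtility_of_nonpos (hw : w ≤ 0) : M.indirectUtility w = 0 := by
  refine le_antisymm ?_ (M.indirectUtility_nonneg w)
  rw [indirectUtility]
  linarith [mul_nonpos_of_nonpos_of_nonneg hw (M.demand_mem w).1,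
    @ENNReal.toReal_nonneg (M.price (M.demand w))]

theorem rightLim_demand_mem (w : ℝ) : Function.rightLim M.demand w ∈ Icc (0 : ℝ) 1 :=
  ⟨(M.demand_mem w).1.trans (M.monotone_demand.le_rightLim le_rfl),
    (M.monotone_demand.rightLim_le (lt_add_one w)).trans (M.demand_mem _).2⟩

theorem rightLim_demand (w : ℝ) : Function.rightLim M.demand w = M.demand w := by
  set y := Function.rightLim M.demand w
  have hy : y ∈ Icc (0 : ℝ) 1 := M.rightLim_demand_mem w
  have hprice : ∀ u, w < u → M.price y ≤ M.price (M.demand u) := fun u hu =>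
    M.monotoneOn hy (M.demand_mem u) (M.monotone_demand.rightLim_le hu)
  have hM : M.price y ≠ ⊤ :=
    ne_top_of_le_ne_top (M.price_demand_ne_top _) (hprice _ (lt_add_one w))
  have hlim : Tendsto (fun u => u * M.demand u - (M.price y).toReal) (𝓝[>] w)
      (𝓝 (w * y - (M.price y).toReal)) :=
    ((tendsto_id.mono_left nhdsWithin_le_nhds).mul
      (M.monotone_demand.tendsto_rightLim w)).sub_const _
  have hU : M.indirectUtility w ≤ w * y - (M.price y).toReal := by
    refine le_of_tendsto_of_tendsto
      (M.continuous_indirectUtility.continuousWithinAt (s := Ioi w)) hlim ?_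
    filter_upwards [self_mem_nhdsWithin] with u hu
    exact sub_le_sub_left (ENNReal.toReal_mono (M.price_demand_ne_top u) (hprice u hu)) _
  exact le_antisymm (isMonopolyChoice_of_indirectUtility_le hy hM hU).le_demand
    (M.monotone_demand.le_rightLim le_rfl)

theorem tendsto_demand_nhdsGT (w : ℝ) : Tendsto M.demand (𝓝[>] w) (𝓝 (M.demand w)) := by
  simpa only [M.rightLim_demand w] using M.monotone_demand.tendsto_rightLim w

end Mechanism

namespace Mechanism

variable (M : Mechanism)

/-- The law `ν` of the marginal price of the probability sold by `M`: for a buyer, facing `M` is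
like facing the posted price `s` with probability `ν (ds)`, and nothing with the rest. -/
noncomputable def postedPriceLaw : Measure ℝ :=
  StieltjesFunction.measure
    ⟨M.demand, M.monotone_demand,
      fun w => continuousWithinAt_Ioi_iff_Ici.1 (M.tendsto_demand_nhdsGT w)⟩

theorem tendsto_demand_atBot : Tendsto M.demand atBot (𝓝 0) :=
  tendsto_const_nhds.congr' <| (eventually_lt_atBot 0).mono fun _ hw => (M.demand_of_neg hw).symm

theorem postedPriceLaw_Iic (w : ℝ) : M.postedPriceLaw (Iic w) = ENNReal.ofReal (M.demand w) := by
  rw [postedPriceLaw, StieltjesFunction.measure_Iic _ M.tendsto_demand_atBot, sub_zero]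

theorem postedPriceLaw_real_Iic (w : ℝ) : M.postedPriceLaw.real (Iic w) = M.demand w := by
  rw [measureReal_def, postedPriceLaw_Iic, ENNReal.toReal_ofReal (M.demand_mem w).1]

theorem postedPriceLaw_univ_le_one : M.postedPriceLaw univ ≤ 1 := by
  have htop : Tendsto M.demand atTop (𝓝 (⨆ w, M.demand w)) :=
    tendsto_atTop_ciSup M.monotone_demand ⟨1, forall_mem_range.2 fun w => (M.demand_mem w).2⟩
  rw [postedPriceLaw, StieltjesFunction.measure_univ _ M.tendsto_demand_atBot htop, sub_zero]
  exact ENNReal.ofReal_le_one.2 (ciSup_le fun w => (M.demand_mem w).2)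

instance : IsFiniteMeasure M.postedPriceLaw :=
  ⟨M.postedPriceLaw_univ_le_one.trans_lt ENNReal.one_lt_top⟩

theorem ae_postedPriceLaw_nonneg : ∀ᵐ s ∂M.postedPriceLaw, 0 ≤ s := by
  have hleft : Function.leftLim M.demand 0 = 0 := leftLim_eq_of_tendsto <|
    tendsto_const_nhds.congr' <|
      eventually_nhdsWithin_of_forall fun _ hw => (M.demand_of_neg hw).symm
  have hnull : M.postedPriceLaw (Iio 0) = 0 := by
    rw [postedPriceLaw, StieltjesFunction.measure_Iio _ M.tendsto_demand_atBot]
    simpa using hleft.le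
  filter_upwards [measure_eq_zero_iff_ae_notMem.1 hnull] with s hs using not_lt.1 hs

theorem integrable_posPart_sub (w : ℝ) :
    Integrable (fun s => max (w - s) 0) M.postedPriceLaw := by
  refine Integrable.of_bound (C := max w 0) (by fun_prop) ?_
  filter_upwards [M.ae_postedPriceLaw_nonneg] with s hs
  rw [Real.norm_eq_abs, abs_of_nonneg (le_max_right _ _)]
  exact max_le_max_right 0 (sub_le_self w hs)

theorem indirectUtility_eq_integral (w : ℝ) :
    M.indirectUtility w = ∫ s, max (w - s) 0 ∂M.postedPriceLaw := by
  have hbound : (fun s => max (w - s) 0) ≤ᵐ[M.postedPriceLaw] fun _ => max w 0 := by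
    filter_upwards [M.ae_postedPriceLaw_nonneg] with s hs
    exact max_le_max_right 0 (sub_le_self w hs)
  have hlevel : ∀ t ∈ Ioc 0 (max w 0),
      M.postedPriceLaw.real {s | t ≤ max (w - s) 0} = M.demand (w - t) := by
    intro t ht
    rw [← postedPriceLaw_real_Iic]
    congr 1 with s
    simp [ht.1.not_ge, le_sub_comm]
  rw [(M.integrable_posPart_sub w).integral_eq_integral_Ioc_meas_le
      (Eventually.of_forall fun s => le_max_right _ _) hbound,
    setIntegral_congr_fun measurableSet_Ioc hlevel,
    ← intervalIntegral.integral_of_le (le_max_right w 0),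
    intervalIntegral.integral_comp_sub_left,
    integral_of_subgradient M.indirectUtility_subgradient M.demand_mem,
    M.indirectUtility_of_nonpos (sub_nonpos.2 (le_max_left w 0)), sub_zero, sub_zero]

theorem price_demand (w : ℝ) :
    M.price (M.demand w) = ∫⁻ s in Iic w, ENNReal.ofReal s ∂M.postedPriceLaw := by
  set ν := M.postedPriceLaw
  have hnonneg : ∀ᵐ s ∂ν.restrict (Iic w), 0 ≤ s := ae_restrict_of_ae M.ae_postedPriceLaw_nonneg
  have hint : IntegrableOn (fun s : ℝ => s) (Iic w) ν := by
    refine Integrable.of_bound (C := w) (by fun_prop) ?_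
    filter_upwards [hnonneg, ae_restrict_mem measurableSet_Iic] with s hs hsw
    rwa [Real.norm_eq_abs, abs_of_nonneg hs]
  have hutility : M.indirectUtility w = w * M.demand w - ∫ s in Iic w, s ∂ν := by
    calc M.indirectUtility w = ∫ s in Iic w, (w - s) ∂ν := by
          rw [indirectUtility_eq_integral, ← integral_indicator measurableSet_Iic]
          refine integral_congr_ae (Eventually.of_forall fun s => ?_)
          rcases le_or_gt s w with hs | hs
          · simp [indicator, hs]
          · simp [indicator, hs.not_ge, hs.le]
      _ = w * M.demand w - ∫ s in Iic w, s ∂ν := by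
          rw [integral_sub (integrable_const _) hint, setIntegral_const, smul_eq_mul,
            postedPriceLaw_real_Iic, mul_comm]
  rw [← ofReal_integral_eq_lintegral_ofReal hint hnonneg,
    ← ENNReal.ofReal_toReal (M.price_demand_ne_top w)]
  congr 1
  rw [indirectUtility] at hutility
  linarith

theorem lintegral_price_demand_comp {μ : Measure ℝ} [SFinite μ] {g : ℝ → ℝ} (hg : Measurable g) :
    ∫⁻ v, M.price (M.demand (g v)) ∂μ
      = ∫⁻ s, ENNReal.ofReal s * μ {v | s ≤ g v} ∂M.postedPriceLaw := by
  have hset : MeasurableSet {q : ℝ × ℝ | q.2 ≤ g q.1} :=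
    measurableSet_le measurable_snd (hg.comp measurable_fst)
  calc ∫⁻ v, M.price (M.demand (g v)) ∂μ
      = ∫⁻ v, ∫⁻ s, {q : ℝ × ℝ | q.2 ≤ g q.1}.indicator (fun q => ENNReal.ofReal q.2) (v, s)
          ∂M.postedPriceLaw ∂μ := by
        refine lintegral_congr fun v => ?_
        rw [price_demand, ← lintegral_indicator measurableSet_Iic]
        rfl
    _ = ∫⁻ s, ∫⁻ v, {q : ℝ × ℝ | q.2 ≤ g q.1}.indicator (fun q => ENNReal.ofReal q.2) (v, s)
          ∂μ ∂M.postedPriceLaw :=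
        lintegral_lintegral_swap
          ((measurable_snd.ennreal_ofReal.indicator hset).aemeasurable)
    _ = ∫⁻ s, ENNReal.ofReal s * μ {v | s ≤ g v} ∂M.postedPriceLaw := by
        refine lintegral_congr fun s => ?_
        rw [← lintegral_indicator_const (measurableSet_le measurable_const hg)]
        rfl

end Mechanism

section Lottery

variable {p : ℝ≥0} {z : ℝ} (hz : z ∈ Icc (0 : ℝ) 1)

theorem lottery_price_ne_top_iff {a : ℝ} : (lottery p z hz).price a ≠ ⊤ ↔ a ≤ z := by
  change lotteryPrice p z a ≠ ⊤ ↔ a ≤ z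
  rw [lotteryPrice]
  split_ifs with h
  · simp [h, ENNReal.mul_eq_top]
  · simp [h]

theorem lottery_price_toReal {a : ℝ} (ha : a ∈ Icc 0 z) :
    ((lottery p z hz).price a).toReal = p * a := by
  change (lotteryPrice p z a).toReal = p * a
  rw [lotteryPrice, if_pos ha.2, ENNReal.toReal_mul, ENNReal.toReal_ofReal ha.1,
    ENNReal.coe_toReal]

theorem isMonopolyChoice_lottery_iff {w a : ℝ} : IsMonopolyChoice (lottery p z hz) w a ↔
    a ∈ Icc 0 z ∧ ∀ y ∈ Icc 0 z, (w - p) * y ≤ (w - p) * a := by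
  simp only [IsMonopolyChoice, lottery_price_ne_top_iff]
  constructor
  · rintro ⟨ha, haz, hmax⟩
    refine ⟨⟨ha.1, haz⟩, fun y hy => ?_⟩
    have := hmax y ⟨hy.1, hy.2.trans hz.2⟩ hy.2
    rw [lottery_price_toReal hz hy, lottery_price_toReal hz ⟨ha.1, haz⟩] at this
    linarith
  · rintro ⟨ha, hmax⟩
    refine ⟨⟨ha.1, ha.2.trans hz.2⟩, ha.2, fun y hy hyz => ?_⟩
    rw [lottery_price_toReal hz ha, lottery_price_toReal hz ⟨hy.1, hyz⟩]
    linarith [hmax y ⟨hy.1, hyz⟩]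

theorem demand_lottery (w : ℝ) :
    (lottery p z hz).demand w = if (p : ℝ) ≤ w then z else 0 := by
  refine ((lottery p z hz).isGreatest_demand w).unique ⟨?_, fun a ha => ?_⟩
  · rw [mem_ofPred_eq, isMonopolyChoice_lottery_iff]
    split_ifs with hw
    · exact ⟨⟨hz.1, le_rfl⟩, fun y hy => mul_le_mul_of_nonneg_left hy.2 (sub_nonneg.2 hw)⟩
    · exact ⟨⟨le_rfl, hz.1⟩, fun y hy =>
        mul_le_mul_of_nonpos_left hy.1 (sub_nonpos.2 (not_le.1 hw).le)⟩
  · obtain ⟨ha, hmax⟩ := (isMonopolyChoice_lottery_iff hz).1 ha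
    split_ifs with hw
    · exact ha.2
    · exact (mul_le_mul_left_of_neg (sub_neg.2 (not_le.1 hw))).1 (hmax 0 ⟨le_rfl, hz.1⟩)

theorem indirectUtility_lottery (w : ℝ) :
    (lottery p z hz).indirectUtility w = z * max (w - p) 0 := by
  rw [Mechanism.indirectUtility, demand_lottery]
  split_ifs with hw
  · rw [lottery_price_toReal hz ⟨hz.1, le_rfl⟩, max_eq_left (sub_nonneg.2 hw)]
    ring
  · simp [lottery_price_toReal hz ⟨le_rfl, hz.1⟩, (not_le.1 hw).le]

end Lottery

/-- The mechanism that sells the good with certainty at the price `v`. -/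
noncomputable def postedPrice (v : ℝ≥0) : Mechanism := lottery v 1 (by simp)

theorem demand_postedPrice (v : ℝ≥0) (w : ℝ) :
    (postedPrice v).demand w = if (v : ℝ) ≤ w then 1 else 0 :=
  demand_lottery _ w

theorem indirectUtility_postedPrice (v : ℝ≥0) (w : ℝ) :
    (postedPrice v).indirectUtility w = max (w - v) 0 := by
  rw [postedPrice, indirectUtility_lottery, one_mul]

theorem price_one_postedPrice (v : ℝ≥0) : (postedPrice v).price 1 = v := by
  simp [postedPrice, lottery, lotteryPrice]

theorem monopolyRev_eq_iSup (D : Measure ℝ) [SFinite D] (hD : D (Iio 0) = 0) :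
    monopolyRev D = ⨆ s : ℝ≥0, s * D (Ici (s : ℝ)) := by
  refine le_antisymm (sSup_le ?_) (iSup_le fun v => ?_)
  · rintro r ⟨M, x, hx, rfl⟩
    calc ∫⁻ v, M.price (x v) ∂D
        ≤ ∫⁻ v, M.price (M.demand v) ∂D := by
          refine lintegral_mono_ae ?_
          filter_upwards [measure_eq_zero_iff_ae_notMem.1 hD] with v hv
          have hchoice := hx v (not_lt.1 hv)
          exact M.monotoneOn hchoice.1 (M.demand_mem v) hchoice.le_demand
      _ = ∫⁻ s, ENNReal.ofReal s * D (Ici s) ∂M.postedPriceLaw :=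
          M.lintegral_price_demand_comp measurable_id
      _ ≤ ∫⁻ _, ⨆ s : ℝ≥0, s * D (Ici (s : ℝ)) ∂M.postedPriceLaw := by
          refine lintegral_mono_ae ?_
          filter_upwards [M.ae_postedPriceLaw_nonneg] with s hs
          lift s to ℝ≥0 using hs
          rw [ENNReal.ofReal_coe_nnreal]
          exact le_iSup (fun s : ℝ≥0 => (s : ℝ≥0∞) * D (Ici (s : ℝ))) s
      _ ≤ ⨆ s : ℝ≥0, s * D (Ici (s : ℝ)) := by
          rw [lintegral_const]
          exact mul_le_of_le_one_right' M.postedPriceLaw_univ_le_one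
  · refine le_sSup_of_le ⟨postedPrice v, (postedPrice v).demand,
      fun w _ => (postedPrice v).isMonopolyChoice_demand w, rfl⟩ ?_
    rw [← setLIntegral_const, ← lintegral_indicator measurableSet_Ici]
    refine lintegral_mono fun w => ?_
    rw [demand_postedPrice]
    by_cases hw : (v : ℝ) ≤ w
    · simp [hw, price_one_postedPrice]
    · simp [hw]

section Atomless

variable {D : Measure ℝ} [IsProbabilityMeasure D] [NullSingletonClass D]

theorem measureReal_Ici_eq_one_sub_cdf (s : ℝ) : D.real (Ici s) = 1 - cdf D s := by
  rw [cdf_eq_real, ← measureReal_congr (Iio_ae_eq_Iic (μ := D) (a := s)), ← compl_Iio,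
    probReal_compl_eq_one_sub measurableSet_Iio]

theorem revenueCurve_eq_mul_measureReal (s : ℝ) : revenueCurve D s = s * D.real (Ici s) := by
  rw [revenueCurve, measureReal_Ici_eq_one_sub_cdf]

theorem ofReal_revenueCurve {s : ℝ} (hs : 0 ≤ s) :
    ENNReal.ofReal (revenueCurve D s) = ENNReal.ofReal s * D (Ici s) := by
  rw [revenueCurve_eq_mul_measureReal, ENNReal.ofReal_mul hs, ofReal_measureReal]

theorem continuous_cdf : Continuous (cdf D) := by
  refine continuous_iff_continuousAt.2 fun s => ?_
  rw [(monotone_cdf D).continuousAt_iff_leftLim_eq_rightLim, StieltjesFunction.rightLim_eq]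
  have hatom : ENNReal.ofReal (cdf D s - Function.leftLim (cdf D) s) = 0 := by
    rw [← StieltjesFunction.measure_singleton, measure_cdf, measure_singleton]
  exact le_antisymm ((monotone_cdf D).leftLim_le le_rfl)
    (sub_nonpos.1 (ENNReal.ofReal_eq_zero.1 hatom))

theorem continuous_revenueCurve : Continuous (revenueCurve D) :=
  continuous_id.mul (continuous_const.sub continuous_cdf)

theorem exists_revenueCurve_pos (hD : D (Iio 0) = 0) : ∃ s : ℝ≥0, 0 < revenueCurve D s := by
  by_contra! h
  have hcdf : ∀ s : ℝ, 0 < s → cdf D s = 1 := fun s hs =>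
    le_antisymm (cdf_le_one D s)
      (sub_nonpos.1 (nonpos_of_mul_nonpos_right (h ⟨s, hs.le⟩) hs))
  have hzero : cdf D 0 = 0 := by
    rw [cdf_eq_real, ← measureReal_congr (Iio_ae_eq_Iic (μ := D) (a := 0)), measureReal_def, hD,
      ENNReal.toReal_zero]
  have hone : cdf D 0 = 1 :=
    tendsto_nhds_unique (continuous_cdf.continuousWithinAt (s := Ioi 0)) <|
      tendsto_const_nhds.congr' <|
        eventually_nhdsWithin_of_forall fun s hs => (hcdf s hs).symm
  exact zero_ne_one (hzero.symm.trans hone)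

theorem monopolyRev_eq_revenueCurve (hD : D (Iio 0) = 0) {v : ℝ≥0}
    (hv : ∀ s : ℝ≥0, revenueCurve D s ≤ revenueCurve D v) :
    monopolyRev D = ENNReal.ofReal (revenueCurve D v) := by
  have hrev : ∀ s : ℝ≥0, s * D (Ici (s : ℝ)) = ENNReal.ofReal (revenueCurve D s) := fun s => by
    rw [ofReal_revenueCurve s.coe_nonneg, ENNReal.ofReal_coe_nnreal]
  simp_rw [monopolyRev_eq_iSup D hD, hrev]
  exact le_antisymm (iSup_le fun s => ENNReal.ofReal_le_ofReal (hv s))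
    (le_iSup (fun s : ℝ≥0 => ENNReal.ofReal (revenueCurve D s)) v)

end Atomless

/-! ### The buyer facing a lottery of Alice -/

section EffectiveValue

variable {p z s v : ℝ}

/-- The value to a buyer of receiving the good from Bob, when the fallback is Alice's lottery with
price `p` and probability `z`. -/
noncomputable def effectiveValue (p z v : ℝ) : ℝ := v - z * max (v - p) 0

/-- The inverse of `effectiveValue`: the value at which a buyer who still has access to the lottery
starts to accept the price `s`. -/
noncomputable def thresholdValue (p z s : ℝ) : ℝ := s + z / (1 - z) * max (s - p) 0

theorem effectiveValue_of_le (h : v ≤ p) : effectiveValue p z v = v := by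
  simp [effectiveValue, h]

theorem effectiveValue_of_ge (h : p ≤ v) : effectiveValue p z v = v - z * (v - p) := by
  rw [effectiveValue, max_eq_left (sub_nonneg.2 h)]

theorem continuous_effectiveValue : Continuous (effectiveValue p z) := by
  unfold effectiveValue; fun_prop

theorem thresholdValue_of_le (h : s ≤ p) : thresholdValue p z s = s := by
  simp [thresholdValue, h]

theorem thresholdValue_of_ge (hz : z < 1) (h : p ≤ s) :
    (1 - z) * thresholdValue p z s = s - z * p := by
  have hz' : 1 - z ≠ 0 := (sub_pos.2 hz).ne'
  rw [thresholdValue, max_eq_left (sub_nonneg.2 h)]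
  field_simp
  ring

theorem le_thresholdValue (hz : z ∈ Ioo (0 : ℝ) 1) : s ≤ thresholdValue p z s :=
  le_add_of_nonneg_right <|
    mul_nonneg (div_nonneg hz.1.le (sub_pos.2 hz.2).le) (le_max_right _ _)

theorem le_effectiveValue_iff (hz : z ∈ Ioo (0 : ℝ) 1) :
    s ≤ effectiveValue p z v ↔ thresholdValue p z s ≤ v := by
  have hz' : 0 < 1 - z := sub_pos.2 hz.2
  rcases le_total v p with hv | hv <;> rcases le_total s p with hs | hs
  · rw [effectiveValue_of_le hv, thresholdValue_of_le hs]
  · rw [effectiveValue_of_le hv, ← mul_le_mul_iff_right₀ hz' (b := thresholdValue p z s),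
      thresholdValue_of_ge hz.2 hs]
    constructor <;> intro h <;> nlinarith [hz.1]
  · rw [effectiveValue_of_ge hv, thresholdValue_of_le hs]
    constructor <;> intro _ <;> nlinarith [hz.1]
  · rw [effectiveValue_of_ge hv, ← mul_le_mul_iff_right₀ hz' (b := thresholdValue p z s),
      thresholdValue_of_ge hz.2 hs]
    constructor <;> intro h <;> linarith

theorem strictMono_effectiveValue (hz : z ∈ Ioo (0 : ℝ) 1) : StrictMono (effectiveValue p z) := by
  intro v w hvw
  have hmax : max (w - p) 0 ≤ max (v - p) 0 + (w - v) :=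
    max_le (by linarith [le_max_left (v - p) 0]) (by linarith [le_max_right (v - p) 0])
  have hlip : z * max (w - p) 0 ≤ z * max (v - p) 0 + z * (w - v) :=
    (mul_le_mul_of_nonneg_left hmax hz.1.le).trans_eq (mul_add _ _ _)
  have hcontr : z * (w - v) < w - v := mul_lt_of_lt_one_left (sub_pos.2 hvw) hz.2
  rw [effectiveValue, effectiveValue]
  linarith

end EffectiveValue

section BobAdvantage

variable {p z w : ℝ} {B : Mechanism}

/-- The utility gain of a buyer of value `w` from visiting Bob before Alice, when Alice offers the
lottery with price `p` and probability `z`, and `p ≤ w`. -/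
noncomputable def bobAdvantage (p z : ℝ) (B : Mechanism) (w : ℝ) : ℝ :=
  B.indirectUtility (effectiveValue p z w) - (1 - z) * B.indirectUtility w

theorem continuous_bobAdvantage : Continuous (bobAdvantage p z B) :=
  (B.continuous_indirectUtility.comp continuous_effectiveValue).sub
    (continuous_const.mul B.continuous_indirectUtility)

theorem bobAdvantage_of_le (h : w ≤ p) : bobAdvantage p z B w = z * B.indirectUtility w := by
  rw [bobAdvantage, effectiveValue_of_le h]
  ring

theorem bobAdvantage_nonneg_of_le (hz : 0 ≤ z) (h : w ≤ p) : 0 ≤ bobAdvantage p z B w := by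
  rw [bobAdvantage_of_le h]
  exact mul_nonneg hz (B.indirectUtility_nonneg w)

/-- The weight of the posted price `s` in the loss from visiting Bob first, as a function of `s`:
a tent, positive exactly on `(p, w)`, with its peak at the effective value of `w`. -/
noncomputable def tent (p z w s : ℝ) : ℝ := min (z * (s - p)) ((1 - z) * max (w - s) 0)

theorem tent_eq_sub (hz : z ∈ Ioo (0 : ℝ) 1) (hw : p ≤ w) (s : ℝ) :
    tent p z w s = (1 - z) * max (w - s) 0 - max (effectiveValue p z w - s) 0 := by
  rw [tent, effectiveValue_of_ge hw]
  rcases le_total w s with hs | hs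
  · have hzw : 0 ≤ z * (w - p) := mul_nonneg hz.1.le (sub_nonneg.2 hw)
    rw [max_eq_right (sub_nonpos.2 hs), max_eq_right (by linarith),
      min_eq_right (by nlinarith [mul_nonneg hz.1.le (sub_nonneg.2 (hw.trans hs))])]
    ring
  · rw [max_eq_left (sub_nonneg.2 hs)]
    rcases le_total (w - z * (w - p) - s) 0 with h | h
    · rw [max_eq_right h, min_eq_right (by linarith), sub_zero]
    · rw [max_eq_left h, min_eq_left (by linarith)]
      ring

theorem tent_of_le_effectiveValue {s : ℝ} (hz : 0 ≤ z) (hw : p ≤ w)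
    (hs : s ≤ effectiveValue p z w) : tent p z w s = z * (s - p) := by
  rw [effectiveValue_of_ge hw] at hs
  rw [tent, max_eq_left (by linarith [mul_nonneg hz (sub_nonneg.2 hw)]), min_eq_left (by linarith)]

theorem tent_of_effectiveValue_le {s : ℝ} (hz : z ∈ Ioo (0 : ℝ) 1) (hw : p ≤ w)
    (hs : effectiveValue p z w ≤ s) : tent p z w s = (1 - z) * max (w - s) 0 := by
  rw [tent_eq_sub hz hw, max_eq_right (sub_nonpos.2 hs), sub_zero]

theorem integrable_tent (hz : z ∈ Ioo (0 : ℝ) 1) (hw : p ≤ w) :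
    Integrable (tent p z w) B.postedPriceLaw := by
  simp_rw [funext (tent_eq_sub hz hw)]
  exact ((B.integrable_posPart_sub _).const_mul _).sub (B.integrable_posPart_sub _)

theorem bobAdvantage_eq_neg_integral_tent (hz : z ∈ Ioo (0 : ℝ) 1) (hw : p ≤ w) :
    bobAdvantage p z B w = -∫ s, tent p z w s ∂B.postedPriceLaw := by
  simp_rw [tent_eq_sub hz hw]
  rw [integral_sub ((B.integrable_posPart_sub _).const_mul _) (B.integrable_posPart_sub _),
    integral_const_mul, ← B.indirectUtility_eq_integral, ← B.indirectUtility_eq_integral, neg_sub,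
    bobAdvantage]

theorem antitoneOn_bobAdvantage (hz : z ∈ Ioo (0 : ℝ) 1) :
    AntitoneOn (bobAdvantage p z B) (Ici p) := by
  intro v hv w hw hvw
  rw [bobAdvantage_eq_neg_integral_tent hz hv, bobAdvantage_eq_neg_integral_tent hz hw]
  refine neg_le_neg (integral_mono (integrable_tent hz hv) (integrable_tent hz hw) fun s => ?_)
  exact min_le_min_left _ (mul_le_mul_of_nonneg_left
    (max_le_max_right 0 (sub_le_sub_right hvw s)) (sub_pos.2 hz.2).le)

/-- While the advantage of visiting Bob first is constantly zero, the derivatives of the two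
utilities agree. -/
theorem demand_le_demand_effectiveValue (hz : z ∈ Ioo (0 : ℝ) 1) {v t : ℝ} (hpv : p ≤ v)
    (hvt : v < t) (hv : bobAdvantage p z B v ≤ 0) (ht : 0 ≤ bobAdvantage p z B t) :
    B.demand v ≤ B.demand (effectiveValue p z v) := by
  have hmono : ∀ u ∈ Ioo v t, B.demand v ≤ B.demand (effectiveValue p z u) := by
    intro u hu
    have hpu : p ≤ u := hpv.trans hu.1.le
    have hu0 : 0 ≤ bobAdvantage p z B u :=
      ht.trans (antitoneOn_bobAdvantage hz hpu (hpu.trans hu.2.le) hu.2.le)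
    have hgap : effectiveValue p z u - effectiveValue p z v = (1 - z) * (u - v) := by
      rw [effectiveValue_of_ge hpu, effectiveValue_of_ge hpv]
      ring
    have hpos : 0 < (1 - z) * (u - v) := mul_pos (sub_pos.2 hz.2) (sub_pos.2 hu.1)
    have hlower := mul_le_mul_of_nonneg_left (B.indirectUtility_subgradient v u)
      (sub_pos.2 hz.2).le
    have hupper := B.indirectUtility_subgradient (effectiveValue p z u) (effectiveValue p z v)
    rw [← neg_sub (effectiveValue p z u), hgap] at hupper
    rw [bobAdvantage] at hv hu0
    refine le_of_mul_le_mul_right ?_ hpos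
    linarith
  have hlim : Tendsto (effectiveValue p z) (𝓝[>] v) (𝓝[>] effectiveValue p z v) :=
    tendsto_nhdsWithin_iff.2 ⟨continuous_effectiveValue.continuousWithinAt,
      eventually_nhdsWithin_of_forall fun _ hu => strictMono_effectiveValue hz hu⟩
  refine ge_of_tendsto ((B.tendsto_demand_nhdsGT _).comp hlim) ?_
  filter_upwards [Ioo_mem_nhdsGT hvt] with u hu using hmono u hu

end BobAdvantage

namespace BuyerPlan

variable {A B : Mechanism} {v : ℝ} {s t : BuyerPlan}

theorem Optimal.utility_le (h : s.Optimal A B v) (ht : t.Feasible A B) :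
    t.utility A B v ≤ s.utility A B v := by
  rcases h.2 t ht with h | h
  · exact h.le
  · exact h.1.le

theorem Feasible.payB_le (h : s.Feasible A B) : s.payB B ≤ (B.price s.b).toReal := by
  refine mul_le_of_le_one_left ENNReal.toReal_nonneg ?_
  rw [reachB]
  split_ifs
  · exact le_rfl
  · linarith [h.1.1]

section Lottery

variable {p : ℝ≥0} {z : ℝ}

theorem feasible_lottery_iff {hz : z ∈ Icc (0 : ℝ) 1} : s.Feasible (lottery p z hz) B ↔
    s.a ∈ Icc 0 z ∧ s.b ∈ Icc (0 : ℝ) 1 ∧ B.price s.b ≠ ⊤ := by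
  rw [Feasible, lottery_price_ne_top_iff]
  exact ⟨fun ⟨ha, hb, haz, hB⟩ => ⟨⟨ha.1, haz⟩, hb, hB⟩,
    fun ⟨ha, hb, hB⟩ => ⟨⟨ha.1, ha.2.trans hz.2⟩, hb, ha.2, hB⟩⟩

theorem payA_lottery {hz : z ∈ Icc (0 : ℝ) 1} (ha : s.a ∈ Icc 0 z) :
    s.payA (lottery p z hz) = s.reachA * (p * s.a) := by
  rw [payA, lottery_price_toReal hz ha]

theorem utility_bobFirst {hz : z ∈ Icc (0 : ℝ) 1} {a b : ℝ} (ha : a ∈ Icc 0 z) :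
    (BuyerPlan.mk true a b).utility (lottery p z hz) B v
      = v * b - (B.price b).toReal + (1 - b) * (a * (v - p)) := by
  simp only [utility, allocA, allocB, payB, payA_lottery (s := ⟨true, a, b⟩) ha, reachA, reachB,
    if_true]
  ring

theorem utility_aliceFirst {hz : z ∈ Icc (0 : ℝ) 1} {a b : ℝ} (ha : a ∈ Icc 0 z) :
    (BuyerPlan.mk false a b).utility (lottery p z hz) B v
      = a * (v - p) + (1 - a) * (v * b - (B.price b).toReal) := by
  simp only [utility, allocA, allocB, payB, payA_lottery (s := ⟨false, a, b⟩) ha, reachA, reachB,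
    Bool.false_eq_true, if_false]
  ring

variable (hz : z ∈ Ioo (0 : ℝ) 1)

theorem Optimal.bobFirst_utility_le (h : s.Optimal (lottery p z (Ioo_subset_Icc_self hz)) B v) :
    z * max (v - p) 0 + B.indirectUtility (effectiveValue p z v)
      ≤ s.utility (lottery p z (Ioo_subset_Icc_self hz)) B v := by
  set A := lottery p z (Ioo_subset_Icc_self hz)
  set w := effectiveValue p z v with hw
  have ha : A.demand v ∈ Icc 0 z := ((isMonopolyChoice_lottery_iff _).1
    (A.isMonopolyChoice_demand v)).1
  have hA : A.demand v * (v - p) = z * max (v - p) 0 := by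
    rw [← indirectUtility_lottery (Ioo_subset_Icc_self hz), Mechanism.indirectUtility,
      lottery_price_toReal _ ha]
    ring
  have hplan := h.utility_le (t := ⟨true, A.demand v, B.demand w⟩)
    (feasible_lottery_iff.2 ⟨ha, B.demand_mem w, B.price_demand_ne_top w⟩)
  rw [utility_bobFirst ha, hA] at hplan
  refine le_trans (le_of_eq ?_) hplan
  rw [Mechanism.indirectUtility, hw, effectiveValue]
  ring

theorem Optimal.aliceFirst_utility_le (h : s.Optimal (lottery p z (Ioo_subset_Icc_self hz)) B v) :
    z * (v - p) + (1 - z) * B.indirectUtility v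
      ≤ s.utility (lottery p z (Ioo_subset_Icc_self hz)) B v := by
  have hmem : z ∈ Icc 0 z := ⟨hz.1.le, le_rfl⟩
  have hplan := h.utility_le (t := ⟨false, z, B.demand v⟩)
    (feasible_lottery_iff.2 ⟨hmem, B.demand_mem v, B.price_demand_ne_top v⟩)
  rwa [utility_aliceFirst hmem] at hplan

theorem Optimal.sub_le_of_a_lt (h : s.Optimal (lottery p z (Ioo_subset_Icc_self hz)) B v)
    (hfirst : s.bobFirst = false) (ha : s.a < z) :
    v - p ≤ v * s.b - (B.price s.b).toReal := by
  obtain ⟨ha', hb, hB⟩ := feasible_lottery_iff.1 h.1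
  have hmem : z ∈ Icc 0 z := ⟨hz.1.le, le_rfl⟩
  have hplan := h.utility_le (t := ⟨false, z, s.b⟩) (feasible_lottery_iff.2 ⟨hmem, hb, hB⟩)
  obtain ⟨bobFirst, a, b⟩ := s
  obtain rfl : bobFirst = false := hfirst
  rw [utility_aliceFirst ha', utility_aliceFirst hmem] at hplan
  exact sub_nonneg.1 (nonneg_of_mul_nonneg_right (by linarith) (sub_pos.2 ha))

theorem Optimal.a_eq (h : s.Optimal (lottery p z (Ioo_subset_Icc_self hz)) B v)
    (hv : p < v) (hb : s.b < 1) : s.a = z := by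
  obtain ⟨ha, hb', hB⟩ := feasible_lottery_iff.1 h.1
  refine ha.2.antisymm (le_of_not_gt fun hlt => ?_)
  have hmem : z ∈ Icc 0 z := ⟨hz.1.le, le_rfl⟩
  have hplan := h.utility_le (t := ⟨true, z, s.b⟩) (feasible_lottery_iff.2 ⟨hmem, hb', hB⟩)
  obtain ⟨_ | _, a, b⟩ := s
  · rw [utility_aliceFirst ha, utility_bobFirst hmem] at hplan
    have hsub := mul_nonneg ha.1 (sub_nonneg.2 (h.sub_le_of_a_lt hz rfl hlt))
    have hpos := mul_pos (sub_pos.2 hb) (mul_pos hz.1 (sub_pos.2 hv))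
    linarith
  · rw [utility_bobFirst ha, utility_bobFirst hmem] at hplan
    have hpos := mul_pos (sub_pos.2 hb) (mul_pos (sub_pos.2 hlt) (sub_pos.2 hv))
    linarith

theorem Optimal.utility_le_or_aliceFirst
    (h : s.Optimal (lottery p z (Ioo_subset_Icc_self hz)) B v) :
    s.utility (lottery p z (Ioo_subset_Icc_self hz)) B v
        ≤ z * max (v - p) 0 + (effectiveValue p z v * s.b - (B.price s.b).toReal) ∨
      (p < v ∧ s.bobFirst = false ∧ s.a = z) := by
  obtain ⟨ha, hb, hB⟩ := feasible_lottery_iff.1 h.1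
  have hbob := h.bobFirst_utility_le hz
  rcases le_or_gt v p with hv | hv
  · left
    rw [effectiveValue_of_le hv, max_eq_right (sub_nonpos.2 hv)] at hbob ⊢
    have hav := mul_nonpos_of_nonneg_of_nonpos ha.1 (sub_nonpos.2 hv)
    obtain ⟨_ | _, a, b⟩ := s
    · rw [utility_aliceFirst ha] at hbob ⊢
      have hu : 0 ≤ v * b - (B.price b).toReal :=
        nonneg_of_mul_nonneg_right (by linarith [B.indirectUtility_nonneg v])
          (sub_pos.2 (ha.2.trans_lt hz.2))
      linarith [mul_nonneg ha.1 hu]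
    · rw [utility_bobFirst ha]
      linarith [mul_nonpos_of_nonneg_of_nonpos (sub_nonneg.2 hb.2) hav]
  · rw [effectiveValue_of_ge hv.le, max_eq_left (sub_pos.2 hv).le]
    by_cases hfull : s.bobFirst = false ∧ s.a = z
    · exact .inr ⟨hv, hfull⟩
    left
    obtain ⟨_ | _, a, b⟩ := s
    · have hlt : a < z := ha.2.lt_of_ne fun h => hfull ⟨rfl, h⟩
      obtain rfl : b = 1 := hb.2.antisymm (le_of_not_gt fun hb1 => hlt.ne (h.a_eq hz hv hb1))
      have hsub := mul_nonneg ha.1 (sub_nonneg.2 (h.sub_le_of_a_lt hz rfl hlt))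
      rw [utility_aliceFirst ha]
      linarith
    · rw [utility_bobFirst ha]
      linarith [mul_le_mul_of_nonneg_left
        (mul_le_mul_of_nonneg_right ha.2 (sub_pos.2 hv).le) (sub_nonneg.2 hb.2)]

theorem Optimal.isMonopolyChoice_effectiveValue
    (h : s.Optimal (lottery p z (Ioo_subset_Icc_self hz)) B v)
    (hle : s.utility (lottery p z (Ioo_subset_Icc_self hz)) B v
      ≤ z * max (v - p) 0 + (effectiveValue p z v * s.b - (B.price s.b).toReal)) :
    IsMonopolyChoice B (effectiveValue p z v) s.b :=
  B.isMonopolyChoice_of_indirectUtility_le h.1.2.1 h.1.2.2.2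
    (by linarith [h.bobFirst_utility_le hz])

theorem Optimal.bobAdvantage_nonneg
    (h : s.Optimal (lottery p z (Ioo_subset_Icc_self hz)) B v)
    (hle : s.utility (lottery p z (Ioo_subset_Icc_self hz)) B v
      ≤ z * max (v - p) 0 + (effectiveValue p z v * s.b - (B.price s.b).toReal)) :
    0 ≤ bobAdvantage p z B v := by
  rcases le_total v p with hv | hv
  · exact bobAdvantage_nonneg_of_le hz.1.le hv
  · have halice := h.aliceFirst_utility_le hz
    have hchoice := B.le_indirectUtility (w := effectiveValue p z v) h.1.2.1 h.1.2.2.2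
    rw [max_eq_left (sub_nonneg.2 hv)] at hle
    rw [bobAdvantage]
    linarith

theorem Optimal.utility_of_aliceFirst
    (h : s.Optimal (lottery p z (Ioo_subset_Icc_self hz)) B v) (hfirst : s.bobFirst = false)
    (ha : s.a = z) : s.utility (lottery p z (Ioo_subset_Icc_self hz)) B v
      = z * (v - p) + (1 - z) * (v * s.b - (B.price s.b).toReal) := by
  obtain ⟨bobFirst, a, b⟩ := s
  obtain rfl : bobFirst = false := hfirst
  obtain rfl : a = z := ha
  exact utility_aliceFirst ⟨hz.1.le, le_rfl⟩

theorem Optimal.isMonopolyChoice_of_aliceFirst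
    (h : s.Optimal (lottery p z (Ioo_subset_Icc_self hz)) B v) (hfirst : s.bobFirst = false)
    (ha : s.a = z) : IsMonopolyChoice B v s.b := by
  refine B.isMonopolyChoice_of_indirectUtility_le h.1.2.1 h.1.2.2.2
    (le_of_mul_le_mul_left ?_ (sub_pos.2 hz.2))
  linarith [h.aliceFirst_utility_le hz, h.utility_of_aliceFirst hz hfirst ha]

theorem Optimal.bobAdvantage_nonpos
    (h : s.Optimal (lottery p z (Ioo_subset_Icc_self hz)) B v) (hv : p ≤ v)
    (hfirst : s.bobFirst = false) (ha : s.a = z) : bobAdvantage p z B v ≤ 0 := by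
  have hbob := h.bobFirst_utility_le hz
  have hchoice := mul_le_mul_of_nonneg_left
    (B.le_indirectUtility (w := v) h.1.2.1 h.1.2.2.2) (sub_pos.2 hz.2).le
  rw [max_eq_left (sub_nonneg.2 hv), h.utility_of_aliceFirst hz hfirst ha] at hbob
  rw [bobAdvantage]
  linarith

theorem Optimal.aliceFirst_of_bobAdvantage_neg
    (h : s.Optimal (lottery p z (Ioo_subset_Icc_self hz)) B v)
    (hadv : bobAdvantage p z B v < 0) : s.bobFirst = false ∧ s.a = z :=
  (h.utility_le_or_aliceFirst hz).elim
    (fun hle => absurd (h.bobAdvantage_nonneg hz hle) hadv.not_ge) And.right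

theorem Optimal.payB_le_price_demand_effectiveValue
    (h : s.Optimal (lottery p z (Ioo_subset_Icc_self hz)) B v) {t : ℝ} (hvt : v < t)
    (ht : 0 ≤ bobAdvantage p z B t) :
    ENNReal.ofReal (s.payB B) ≤ B.price (B.demand (effectiveValue p z v)) := by
  have hb : s.b ≤ B.demand (effectiveValue p z v) := by
    rcases h.utility_le_or_aliceFirst hz with hle | ⟨hv, hfirst, ha⟩
    · exact (h.isMonopolyChoice_effectiveValue hz hle).le_demand
    · exact (h.isMonopolyChoice_of_aliceFirst hz hfirst ha).le_demand.trans <|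
        demand_le_demand_effectiveValue hz hv.le hvt (h.bobAdvantage_nonpos hz hv.le hfirst ha) ht
  exact (ENNReal.ofReal_le_of_le_toReal h.1.payB_le).trans
    (B.monotoneOn h.1.2.1 (B.demand_mem _) hb)

theorem payB_of_aliceFirst (hfirst : s.bobFirst = false) (ha : s.a = z) :
    s.payB B = (1 - z) * (B.price s.b).toReal := by
  simp [payB, reachB, hfirst, ha]

theorem Optimal.payB_le_of_bobAdvantage_neg
    (h : s.Optimal (lottery p z (Ioo_subset_Icc_self hz)) B v)
    (hadv : bobAdvantage p z B v < 0) :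
    ENNReal.ofReal (s.payB B) ≤ ENNReal.ofReal (1 - z) * B.price (B.demand v) := by
  obtain ⟨hfirst, ha⟩ := h.aliceFirst_of_bobAdvantage_neg hz hadv
  rw [payB_of_aliceFirst hfirst ha, ENNReal.ofReal_mul (sub_pos.2 hz.2).le,
    ENNReal.ofReal_toReal h.1.2.2.2]
  gcongr
  exact B.monotoneOn h.1.2.1 (B.demand_mem _)
    (h.isMonopolyChoice_of_aliceFirst hz hfirst ha).le_demand

theorem Optimal.payA_eq (h : s.Optimal (lottery p z (Ioo_subset_Icc_self hz)) B v) (hv : p < v)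
    (hbob : bobAdvantage p z B v < 0 ∨ B.demand (effectiveValue p z v) = 0) :
    s.payA (lottery p z (Ioo_subset_Icc_self hz)) = z * p := by
  have haz : s.reachA = 1 ∧ s.a = z := by
    rcases h.utility_le_or_aliceFirst hz with hle | ⟨-, hfirst, ha⟩
    · have hdemand := hbob.resolve_left (h.bobAdvantage_nonneg hz hle).not_gt
      have hb : s.b = 0 := le_antisymm
        ((h.isMonopolyChoice_effectiveValue hz hle).le_demand.trans_eq hdemand) h.1.2.1.1
      exact ⟨by simp [reachA, hb], h.a_eq hz hv (by simp [hb])⟩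
    · exact ⟨by simp [reachA, hfirst], ha⟩
  rw [payA_lottery (feasible_lottery_iff.1 h.1).1, haz.1, haz.2]
  ring

end Lottery

end BuyerPlan

/-! ### Bounding Bob's revenue -/

theorem measureReal_Ico (D : Measure ℝ) [IsFiniteMeasure D] {r t : ℝ} (h : r ≤ t) :
    D.real (Ico r t) = D.real (Ici r) - D.real (Ici t) := by
  rw [← Ici_sdiff_Ici, measureReal_sdiff (Ici_subset_Ici.2 h) measurableSet_Ici]

section RevenueBound

variable {D : Measure ℝ} [IsProbabilityMeasure D] [NullSingletonClass D]

theorem mul_measureReal_Ici_thresholdValue_le {p z m s : ℝ} (hz : z ∈ Ioo (0 : ℝ) 1) (hp : 0 ≤ p)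
    (hm : ∀ q, 0 ≤ q → revenueCurve D q ≤ revenueCurve D p + m * (q - p)) (hs : 0 ≤ s) :
    s * D.real (Ici (thresholdValue p z s)) ≤ revenueCurve D p + m * (s - p) := by
  rcases le_total s p with hsp | hsp
  · rw [thresholdValue_of_le hsp, ← revenueCurve_eq_mul_measureReal]
    exact hm s hs
  · set r := thresholdValue p z s
    have hr : (1 - z) * r = s - z * p := thresholdValue_of_ge hz.2 hsp
    have hpr : p ≤ r := hsp.trans (le_thresholdValue hz)
    have hcurve := mul_le_mul_of_nonneg_left (hm r (hp.trans hpr)) (sub_pos.2 hz.2).le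
    have htail : z * p * D.real (Ici r) ≤ z * revenueCurve D p := by
      rw [revenueCurve_eq_mul_measureReal p, ← mul_assoc]
      exact mul_le_mul_of_nonneg_left (measureReal_mono (Ici_subset_Ici.2 hpr))
        (mul_nonneg hz.1.le hp)
    rw [revenueCurve_eq_mul_measureReal r] at hcurve
    linear_combination hcurve + htail + (m - D.real (Ici r)) * hr

/-- The left-hand side is the revenue from the posted price `s` when the buyers below `t` visit Bob
first and, weighted by `c`, those above `t` visit Alice first. -/
theorem postedPrice_revenue_le {p z m g t s c : ℝ} (hz : z ∈ Ioo (0 : ℝ) 1) (hp : 0 ≤ p)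
    (hm0 : 0 ≤ m) (hm : ∀ q, 0 ≤ q → revenueCurve D q ≤ revenueCurve D p + m * (q - p))
    (hg : ∀ q, 0 ≤ q → revenueCurve D q ≤ g) (ht : p ≤ t) (hc : c ∈ Icc (0 : ℝ) 1) (hs : 0 ≤ s) :
    s * D.real (Ico (thresholdValue p z s) t) + c * ((1 - z) * (s * D.real (Ici (max t s))))
      ≤ (if s ≤ effectiveValue p z t then revenueCurve D p else (1 - z) * g)
        + (m / z - c * D.real (Ici t)) * tent p z t s := by
  have hz' := sub_pos.2 hz.2
  have hT : 0 ≤ D.real (Ici t) := measureReal_nonneg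
  split_ifs with hset
  · have hst : s ≤ t := hset.trans <| by
      rw [effectiveValue_of_ge ht]
      exact sub_le_self t (mul_nonneg hz.1.le (sub_nonneg.2 ht))
    have hscale : m / z * (z * (s - p)) = m * (s - p) := by
      rw [← mul_assoc, div_mul_cancel₀ m hz.1.ne']
    have hlow := mul_measureReal_Ici_thresholdValue_le hz hp hm hs
    have hsT := mul_nonneg (sub_nonneg.2 hc.2) (mul_nonneg hs hT)
    have hpT := mul_nonneg hc.1 (mul_nonneg hz.1.le (mul_nonneg hp hT))
    rw [measureReal_Ico D ((le_effectiveValue_iff hz).1 hset), max_eq_left hst,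
      tent_of_le_effectiveValue hz.1.le ht hset, sub_mul (m / z), hscale]
    linarith
  · have hcg : ∀ q, 0 ≤ q → c * revenueCurve D q ≤ g := fun q hq =>
      (mul_le_mul_of_nonneg_left (hg q hq) hc.1).trans <|
        mul_le_of_le_one_left (by simpa [revenueCurve] using hg 0 le_rfl) hc.2
    rw [Ico_eq_empty (fun h => hset ((le_effectiveValue_iff hz).2 h.le)), measureReal_empty,
      mul_zero, zero_add, tent_of_effectiveValue_le hz ht (not_le.1 hset).le]
    rcases le_total t s with hts | hts
    · rw [max_eq_right hts, max_eq_right (sub_nonpos.2 hts), ← revenueCurve_eq_mul_measureReal]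
      linarith [mul_le_mul_of_nonneg_left (hcg s hs) hz'.le]
    · rw [max_eq_left hts, max_eq_left (sub_nonneg.2 hts)]
      have hpeak := mul_nonneg (div_nonneg hm0 hz.1.le) (mul_nonneg hz'.le (sub_nonneg.2 hts))
      have hcurve := mul_le_mul_of_nonneg_left (hcg t (hp.trans ht)) hz'.le
      rw [revenueCurve_eq_mul_measureReal] at hcurve
      linarith

end RevenueBound

theorem lintegral_postedPriceLaw_le {B : Mechanism} {p z t a b l : ℝ} {F : ℝ → ℝ}
    (hz : z ∈ Ioo (0 : ℝ) 1) (ht : p ≤ t) (hb : 0 ≤ b) (hl : 0 ≤ l * bobAdvantage p z B t)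
    (hF0 : ∀ s, 0 ≤ s → 0 ≤ F s)
    (hF : ∀ s, 0 ≤ s → F s ≤ (if s ≤ effectiveValue p z t then a else b) + l * tent p z t s) :
    ∫⁻ s, ENNReal.ofReal (F s) ∂B.postedPriceLaw
      ≤ ENNReal.ofReal (b - (b - a) * B.demand (effectiveValue p z t)) := by
  set ν := B.postedPriceLaw
  set e := effectiveValue p z t
  have hite : (fun s => if s ≤ e then a else b)
      = fun s => b - (Iic e).indicator (fun _ => b - a) s := by
    funext s
    by_cases hs : s ≤ e <;> simp [hs]
  have hint : Integrable (fun s => if s ≤ e then a else b) ν := by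
    rw [hite]
    exact (integrable_const b).sub ((integrable_const _).indicator measurableSet_Iic)
  have htent := (integrable_tent (B := B) hz ht).const_mul l
  have hmass : b * ν.real univ ≤ b := mul_le_of_le_one_right hb <|
    ENNReal.toReal_le_of_le_ofReal zero_le_one (by simpa using B.postedPriceLaw_univ_le_one)
  calc ∫⁻ s, ENNReal.ofReal (F s) ∂ν
      ≤ ∫⁻ s, ENNReal.ofReal ((if s ≤ e then a else b) + l * tent p z t s) ∂ν := by
        refine lintegral_mono_ae ?_
        filter_upwards [B.ae_postedPriceLaw_nonneg] with s hs
        exact ENNReal.ofReal_le_ofReal (hF s hs)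
    _ = ENNReal.ofReal (∫ s, ((if s ≤ e then a else b) + l * tent p z t s) ∂ν) := by
        refine (ofReal_integral_eq_lintegral_ofReal (hint.add htent) ?_).symm
        filter_upwards [B.ae_postedPriceLaw_nonneg] with s hs
        exact (hF0 s hs).trans (hF s hs)
    _ ≤ ENNReal.ofReal (b - (b - a) * B.demand e) := by
        refine ENNReal.ofReal_le_ofReal ?_
        rw [integral_add hint htent, hite,
          integral_sub (integrable_const b) ((integrable_const _).indicator measurableSet_Iic),
          integral_indicator measurableSet_Iic, setIntegral_const, integral_const,
          integral_const_mul, B.postedPriceLaw_real_Iic, smul_eq_mul, smul_eq_mul]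
        rw [bobAdvantage_eq_neg_integral_tent hz ht] at hl
        linarith

theorem forall_nonneg_or_exists_eq_zero {f : ℝ → ℝ} {t : ℝ} (hf : Continuous f)
    (hanti : AntitoneOn f (Ici t)) (ht : 0 ≤ f t) :
    (∀ w, t ≤ w → 0 ≤ f w) ∨ ∃ T, t ≤ T ∧ f T = 0 ∧ ∀ w, T < w → f w < 0 := by
  by_cases hall : ∀ w, t ≤ w → 0 ≤ f w
  · exact .inl hall
  push Not at hall
  obtain ⟨u, htu, hu⟩ := hall
  have hcompact : IsCompact (Icc t u ∩ f ⁻¹' {0}) :=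
    isCompact_Icc.inter_right (isClosed_singleton.preimage hf)
  obtain ⟨x, hx, hx0⟩ := intermediate_value_Icc' htu hf.continuousOn ⟨hu.le, ht⟩
  obtain ⟨T, ⟨hT, hT0⟩, hmax⟩ := hcompact.exists_isGreatest ⟨x, hx, hx0⟩
  refine .inr ⟨T, hT.1, hT0, fun w hw => lt_of_le_of_ne ?_ fun hw0 => ?_⟩
  · exact (hanti hT.1 (hT.1.trans hw.le) hw.le).trans_eq hT0
  · have hwu : w ≤ u := le_of_not_gt fun huw =>
      hu.not_ge (hw0.ge.trans (hanti htu (htu.trans huw.le) huw.le))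
    exact hw.not_ge (hmax ⟨⟨hT.1.trans hw.le, hwu⟩, hw0⟩)

section BobRevenue

variable {D : Measure ℝ} [IsProbabilityMeasure D] {σ : BuyerRule} {B : Mechanism} {p : ℝ≥0}
  {z t : ℝ}

theorem setLIntegral_Iio_payB_le (hσ : σ.IsOptimal) (hD : D (Iio 0) = 0) (hz : z ∈ Ioo (0 : ℝ) 1)
    (ht : 0 ≤ bobAdvantage p z B t) :
    ∫⁻ v in Iio t,
        ENNReal.ofReal ((σ (lottery p z (Ioo_subset_Icc_self hz)) B v).payB B) ∂D
      ≤ ∫⁻ s, ENNReal.ofReal (s * D.real (Ico (thresholdValue p z s) t)) ∂B.postedPriceLaw := by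
  calc _ ≤ ∫⁻ v in Iio t, B.price (B.demand (effectiveValue p z v)) ∂D := by
        refine lintegral_mono_ae ?_
        filter_upwards [ae_restrict_of_ae (measure_eq_zero_iff_ae_notMem.1 hD),
          ae_restrict_mem measurableSet_Iio] with v hv hvt
        exact (hσ _ B v (not_lt.1 hv)).payB_le_price_demand_effectiveValue hz hvt ht
    _ = ∫⁻ s, ENNReal.ofReal s * D.restrict (Iio t) {v | s ≤ effectiveValue p z v}
          ∂B.postedPriceLaw :=
        B.lintegral_price_demand_comp continuous_effectiveValue.measurable
    _ = _ := by
        refine lintegral_congr fun s => ?_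
        have hset : {v | s ≤ effectiveValue p z v} = Ici (thresholdValue p z s) :=
          ext fun v => le_effectiveValue_iff hz
        rw [hset, Measure.restrict_apply measurableSet_Ici, Ici_inter_Iio,
          ENNReal.ofReal_mul' measureReal_nonneg, ofReal_measureReal]

variable [NullSingletonClass D]

theorem setLIntegral_Ici_payB_le (hσ : σ.IsOptimal) (hD : D (Iio 0) = 0) (hz : z ∈ Ioo (0 : ℝ) 1)
    (ht : ∀ w, t < w → bobAdvantage p z B w < 0) :
    ∫⁻ v in Ici t,
        ENNReal.ofReal ((σ (lottery p z (Ioo_subset_Icc_self hz)) B v).payB B) ∂D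
      ≤ ∫⁻ s, ENNReal.ofReal ((1 - z) * (s * D.real (Ici (max t s)))) ∂B.postedPriceLaw := by
  rw [← Measure.restrict_congr_set (Ioi_ae_eq_Ici (μ := D) (a := t))]
  calc _ ≤ ∫⁻ v in Ioi t, ENNReal.ofReal (1 - z) * B.price (B.demand v) ∂D := by
        refine lintegral_mono_ae ?_
        filter_upwards [ae_restrict_of_ae (measure_eq_zero_iff_ae_notMem.1 hD),
          ae_restrict_mem measurableSet_Ioi] with v hv hvt
        exact (hσ _ B v (not_lt.1 hv)).payB_le_of_bobAdvantage_neg hz (ht v hvt)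
    _ = ENNReal.ofReal (1 - z) * ∫⁻ s, ENNReal.ofReal s * D.restrict (Ioi t) {v | s ≤ v}
          ∂B.postedPriceLaw := by
        rw [lintegral_const_mul' _ _ ENNReal.ofReal_ne_top]
        exact congrArg _ (B.lintegral_price_demand_comp measurable_id)
    _ = _ := by
        rw [← lintegral_const_mul' _ _ ENNReal.ofReal_ne_top,
          Measure.restrict_congr_set (Ioi_ae_eq_Ici (μ := D) (a := t))]
        refine lintegral_congr fun s => ?_
        rw [ENNReal.ofReal_mul (sub_pos.2 hz.2).le, ENNReal.ofReal_mul' measureReal_nonneg,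
          ofReal_measureReal, sup_comm, ← Ici_inter_Ici,
          ← Measure.restrict_apply measurableSet_Ici]
        rfl

variable {m g : ℝ}

theorem setLIntegral_Iio_payB_le_of_supergradient (hσ : σ.IsOptimal) (hD : D (Iio 0) = 0)
    (hz : z ∈ Ioo (0 : ℝ) 1) (hm0 : 0 ≤ m)
    (hm : ∀ q, 0 ≤ q → revenueCurve D q ≤ revenueCurve D p + m * (q - p))
    (hg : ∀ q, 0 ≤ q → revenueCurve D q ≤ g) (hpt : p ≤ t) (ht : 0 ≤ bobAdvantage p z B t) :
    ∫⁻ v in Iio t,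
        ENNReal.ofReal ((σ (lottery p z (Ioo_subset_Icc_self hz)) B v).payB B) ∂D
      ≤ ENNReal.ofReal ((1 - z) * g
        - ((1 - z) * g - revenueCurve D p) * B.demand (effectiveValue p z t)) := by
  have hg0 : 0 ≤ g := by simpa [revenueCurve] using hg 0 le_rfl
  refine (setLIntegral_Iio_payB_le hσ hD hz ht).trans <|
    lintegral_postedPriceLaw_le (l := m / z) hz hpt (mul_nonneg (sub_pos.2 hz.2).le hg0)
      (mul_nonneg (div_nonneg hm0 hz.1.le) ht) (fun s hs => mul_nonneg hs measureReal_nonneg)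
      fun s hs => ?_
  simpa using postedPrice_revenue_le hz p.coe_nonneg hm0 hm hg hpt ⟨le_rfl, zero_le_one⟩ hs

theorem revB_le_of_bobAdvantage_eq_zero (hσ : σ.IsOptimal) (hD : D (Iio 0) = 0)
    (hz : z ∈ Ioo (0 : ℝ) 1) (hm0 : 0 ≤ m)
    (hm : ∀ q, 0 ≤ q → revenueCurve D q ≤ revenueCurve D p + m * (q - p))
    (hg : ∀ q, 0 ≤ q → revenueCurve D q ≤ g) (hpt : p ≤ t) (ht : bobAdvantage p z B t = 0)
    (htneg : ∀ w, t < w → bobAdvantage p z B w < 0) :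
    revB σ D (lottery p z (Ioo_subset_Icc_self hz)) B
      ≤ ENNReal.ofReal ((1 - z) * g
        - ((1 - z) * g - revenueCurve D p) * B.demand (effectiveValue p z t)) := by
  have hg0 : 0 ≤ g := by simpa [revenueCurve] using hg 0 le_rfl
  have hz' := (sub_pos.2 hz.2).le
  have htail : Measurable fun s => D.real (Ici (max t s)) := Antitone.measurable fun s r hsr =>
    measureReal_mono (Ici_subset_Ici.2 (max_le_max_left t hsr))
  rw [revB, ← lintegral_add_compl _ (measurableSet_Iio (a := t)), compl_Iio]
  calc _ ≤ _ := add_le_add (setLIntegral_Iio_payB_le hσ hD hz ht.ge)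
        (setLIntegral_Ici_payB_le hσ hD hz htneg)
    _ = ∫⁻ s, ENNReal.ofReal (s * D.real (Ico (thresholdValue p z s) t)
          + 1 * ((1 - z) * (s * D.real (Ici (max t s))))) ∂B.postedPriceLaw := by
        rw [← lintegral_add_right _ (by fun_prop)]
        refine lintegral_congr_ae ?_
        filter_upwards [B.ae_postedPriceLaw_nonneg] with s hs
        rw [one_mul, ENNReal.ofReal_add (mul_nonneg hs measureReal_nonneg)
          (mul_nonneg hz' (mul_nonneg hs measureReal_nonneg))]
    _ ≤ _ := by
        refine lintegral_postedPriceLaw_le (l := m / z - 1 * D.real (Ici t)) hz hpt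
          (mul_nonneg hz' hg0) (by rw [ht, mul_zero]) (fun s hs => ?_) fun s hs =>
            postedPrice_revenue_le hz p.coe_nonneg hm0 hm hg hpt ⟨zero_le_one, le_rfl⟩ hs
        exact add_nonneg (mul_nonneg hs measureReal_nonneg)
          (mul_nonneg zero_le_one (mul_nonneg hz' (mul_nonneg hs measureReal_nonneg)))

theorem revB_le_of_bobAdvantage_nonneg (hσ : σ.IsOptimal) (hD : D (Iio 0) = 0)
    (hz : z ∈ Ioo (0 : ℝ) 1) (hm0 : 0 ≤ m)
    (hm : ∀ q, 0 ≤ q → revenueCurve D q ≤ revenueCurve D p + m * (q - p))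
    (hg : ∀ q, 0 ≤ q → revenueCurve D q ≤ g) (hpg : revenueCurve D p ≤ (1 - z) * g)
    (hpt : p ≤ t) (ht : ∀ w, t ≤ w → 0 ≤ bobAdvantage p z B w) :
    revB σ D (lottery p z (Ioo_subset_Icc_self hz)) B
      ≤ ENNReal.ofReal ((1 - z) * g
        - ((1 - z) * g - revenueCurve D p) * B.demand (effectiveValue p z t)) := by
  have hcover : ⋃ n : ℕ, Iio (t + n) = univ := iUnion_eq_univ_iff.2 fun v => by
    obtain ⟨n, hn⟩ := exists_nat_gt (v - t)
    exact ⟨n, by rw [mem_Iio]; linarith⟩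
  have hmono : Monotone fun n : ℕ => Iio (t + n) := fun n k hnk =>
    Iio_subset_Iio (by gcongr)
  rw [revB, ← setLIntegral_univ, ← hcover, setLIntegral_iUnion_of_directed _ hmono.directed_le]
  refine iSup_le fun n => ?_
  have htn : t ≤ t + n := le_add_of_nonneg_right n.cast_nonneg
  refine (setLIntegral_Iio_payB_le_of_supergradient hσ hD hz hm0 hm hg (hpt.trans htn)
    (ht _ htn)).trans (ENNReal.ofReal_le_ofReal ?_)
  exact sub_le_sub_left (mul_le_mul_of_nonneg_left
    (B.monotone_demand ((strictMono_effectiveValue hz).monotone htn)) (sub_nonneg.2 hpg)) _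

/-- Bob loses `(1 - z) * g - Γ p` against the optimal response on every sale to a buyer with a
value above `p` who visits him first. -/
theorem revB_le (hσ : σ.IsOptimal) (hD : D (Iio 0) = 0)
    (hz : z ∈ Ioo (0 : ℝ) 1) (hm0 : 0 ≤ m)
    (hm : ∀ q, 0 ≤ q → revenueCurve D q ≤ revenueCurve D p + m * (q - p))
    (hg : ∀ q, 0 ≤ q → revenueCurve D q ≤ g) (hpg : revenueCurve D p ≤ (1 - z) * g)
    (hpt : p ≤ t) (ht : 0 ≤ bobAdvantage p z B t) :
    revB σ D (lottery p z (Ioo_subset_Icc_self hz)) B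
      ≤ ENNReal.ofReal ((1 - z) * g
        - ((1 - z) * g - revenueCurve D p) * B.demand (effectiveValue p z t)) := by
  rcases forall_nonneg_or_exists_eq_zero continuous_bobAdvantage
    ((antitoneOn_bobAdvantage hz).mono (Ici_subset_Ici.2 hpt)) ht with hall | ⟨T, hT, hT0, hneg⟩
  · exact revB_le_of_bobAdvantage_nonneg hσ hD hz hm0 hm hg hpg hpt hall
  · refine (revB_le_of_bobAdvantage_eq_zero hσ hD hz hm0 hm hg (hpt.trans hT) hT0 hneg).trans
      (ENNReal.ofReal_le_ofReal ?_)
    exact sub_le_sub_left (mul_le_mul_of_nonneg_left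
      (B.monotone_demand ((strictMono_effectiveValue hz).monotone hT)) (sub_nonneg.2 hpg)) _

end BobRevenue

/-! ### Bob's best responses -/

theorem exists_supergradient_of_isMaxOn {f : ℝ → ℝ} {a v p : ℝ} (hf : ConcaveOn ℝ (Icc a v) f)
    (hp : p ∈ Ioo a v) (hv : ∀ q, a ≤ q → f q ≤ f v) :
    ∃ m, 0 ≤ m ∧ ∀ q, a ≤ q → f q ≤ f p + m * (q - p) := by
  have hint : p ∈ interior (Icc a v) := by rwa [interior_Icc]
  have hconv : ConvexOn ℝ (Icc a v) (-f) := hf.neg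
  obtain ⟨m, hm⟩ : ∃ m, ∀ q ∈ Icc a v, f q ≤ f p + m * (q - p) := by
    refine ⟨-derivWithin (-f) (Ioi p) p, fun q hq => ?_⟩
    rcases lt_trichotomy q p with hqp | rfl | hpq
    · have h := (hconv.slope_le_leftDeriv_of_mem_interior hq hint hqp).trans
        (hconv.leftDeriv_le_rightDeriv_of_mem_interior hint)
      rw [slope_def_field, div_le_iff₀ (sub_pos.2 hqp)] at h
      simp only [Pi.neg_apply] at h
      linarith
    · simp
    · have h := hconv.rightDeriv_le_slope_of_mem_interior hint hq hpq
      rw [slope_def_field, le_div_iff₀ (sub_pos.2 hpq)] at h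
      simp only [Pi.neg_apply] at h
      linarith
  have hmv := hm v ⟨(hp.1.trans hp.2).le, le_rfl⟩
  have hm0 : 0 ≤ m := nonneg_of_mul_nonneg_left
    (by linarith [hv p hp.1.le] : 0 ≤ m * (v - p)) (sub_pos.2 hp.2)
  refine ⟨m, hm0, fun q hq => ?_⟩
  rcases le_total q v with hqv | hvq
  · exact hm q ⟨hq, hqv⟩
  · linarith [hv q hq, mul_le_mul_of_nonneg_left hvq hm0]

section Responses

variable {D : Measure ℝ} [IsProbabilityMeasure D] [NullSingletonClass D] {σ : BuyerRule}
  {B : Mechanism} {p v : ℝ≥0} {z : ℝ}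

theorem bobAdvantage_postedPrice_neg (hz : z ∈ Ioo (0 : ℝ) 1) (hpv : p < v) {w : ℝ} (hw : v < w) :
    bobAdvantage p z (postedPrice v) w < 0 := by
  have hpv' : (p : ℝ) < v := hpv
  have hz' : 0 < 1 - z := sub_pos.2 hz.2
  rw [bobAdvantage, effectiveValue_of_ge (hpv'.trans hw).le, indirectUtility_postedPrice,
    indirectUtility_postedPrice, max_eq_left (sub_pos.2 hw).le, sub_neg, max_lt_iff]
  constructor
  · linarith [mul_pos hz.1 (sub_pos.2 hpv')]
  · exact mul_pos hz' (sub_pos.2 hw)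

theorem bobAdvantage_postedPrice_neg_or_demand_eq_zero (hz : z ∈ Ioo (0 : ℝ) 1) (hpv : p < v)
    {w : ℝ} (hw : p < w) : bobAdvantage p z (postedPrice v) w < 0 ∨
      (postedPrice v).demand (effectiveValue p z w) = 0 := by
  rcases lt_or_ge (v : ℝ) w with hvw | hvw
  · exact .inl (bobAdvantage_postedPrice_neg hz hpv hvw)
  · have he : effectiveValue p z w < v := by
      rw [effectiveValue_of_ge hw.le]
      linarith [mul_pos hz.1 (sub_pos.2 hw)]
    exact .inr (by rw [demand_postedPrice, if_neg he.not_ge])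

theorem ofReal_mul_revenueCurve (hz : 0 ≤ z) :
    ENNReal.ofReal (z * revenueCurve D p) = ∫⁻ _ in Ioi (p : ℝ), ENNReal.ofReal (z * p) ∂D := by
  rw [ENNReal.ofReal_mul hz, ofReal_revenueCurve p.coe_nonneg, setLIntegral_const,
    measure_congr (Ioi_ae_eq_Ici (μ := D) (a := (p : ℝ))), ENNReal.ofReal_mul hz, mul_assoc]

theorem le_revA (hσ : σ.IsOptimal) (hz : z ∈ Ioo (0 : ℝ) 1)
    (hbob : ∀ w : ℝ, p < w →
      bobAdvantage p z B w < 0 ∨ B.demand (effectiveValue p z w) = 0) :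
    ENNReal.ofReal (z * revenueCurve D p)
      ≤ revA σ D (lottery p z (Ioo_subset_Icc_self hz)) B := by
  rw [ofReal_mul_revenueCurve hz.1.le]
  refine (setLIntegral_mono' measurableSet_Ioi fun w hw => ?_).trans (setLIntegral_le_lintegral _ _)
  rw [(hσ _ B w (p.coe_nonneg.trans (le_of_lt hw))).payA_eq hz hw (hbob w hw)]

theorem le_revB_postedPrice (hσ : σ.IsOptimal) (hz : z ∈ Ioo (0 : ℝ) 1) (hpv : p < v) :
    ENNReal.ofReal ((1 - z) * revenueCurve D v)
      ≤ revB σ D (lottery p z (Ioo_subset_Icc_self hz)) (postedPrice v) := by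
  rw [ofReal_mul_revenueCurve (sub_pos.2 hz.2).le]
  refine (setLIntegral_mono' measurableSet_Ioi fun w hw => ?_).trans (setLIntegral_le_lintegral _ _)
  have hopt := hσ (lottery p z (Ioo_subset_Icc_self hz)) (postedPrice v) w
    (v.coe_nonneg.trans (le_of_lt hw))
  obtain ⟨hfirst, ha⟩ :=
    hopt.aliceFirst_of_bobAdvantage_neg hz (bobAdvantage_postedPrice_neg hz hpv hw)
  obtain ⟨hb, hmax⟩ := (isMonopolyChoice_lottery_iff _).1
    (hopt.isMonopolyChoice_of_aliceFirst hz hfirst ha)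
  have hb1 := le_of_mul_le_mul_left (hmax 1 ⟨zero_le_one, le_rfl⟩) (sub_pos.2 hw)
  rw [BuyerPlan.payB_of_aliceFirst hfirst ha, hb.2.antisymm hb1, price_one_postedPrice,
    ENNReal.coe_toReal]

theorem isBestResponse_postedPrice (hσ : σ.IsOptimal) (hD : D (Iio 0) = 0)
    (hz : z ∈ Ioo (0 : ℝ) 1) (hΓ : ConcaveOn ℝ (Icc 0 (v : ℝ)) (revenueCurve D))
    (hv : ∀ q : ℝ≥0, revenueCurve D q ≤ revenueCurve D v) (hp : p ∈ Ioo 0 v)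
    (hpz : revenueCurve D p ≤ (1 - z) * revenueCurve D v) :
    IsBestResponse σ D (lottery p z (Ioo_subset_Icc_self hz)) (postedPrice v) := fun B => by
  obtain ⟨m, hm0, hm⟩ := exists_supergradient_of_isMaxOn hΓ hp fun q hq => hv ⟨q, hq⟩
  calc _ ≤ _ := revB_le hσ hD hz hm0 hm (fun q hq => hv ⟨q, hq⟩) hpz le_rfl
        (bobAdvantage_nonneg_of_le hz.1.le le_rfl)
    _ ≤ ENNReal.ofReal ((1 - z) * revenueCurve D v) := ENNReal.ofReal_le_ofReal
        (sub_le_self _ (mul_nonneg (sub_nonneg.2 hpz) (B.demand_mem _).1))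
    _ ≤ _ := le_revB_postedPrice hσ hz hp.2

theorem le_revA_of_isBestResponse (hσ : σ.IsOptimal) (hD : D (Iio 0) = 0)
    (hz : z ∈ Ioo (0 : ℝ) 1) (hΓ : ConcaveOn ℝ (Icc 0 (v : ℝ)) (revenueCurve D))
    (hv : ∀ q : ℝ≥0, revenueCurve D q ≤ revenueCurve D v) (hp : p ∈ Ioo 0 v)
    (hpz : revenueCurve D p < (1 - z) * revenueCurve D v)
    (hB : IsBestResponse σ D (lottery p z (Ioo_subset_Icc_self hz)) B) :
    ENNReal.ofReal (z * revenueCurve D p)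
      ≤ revA σ D (lottery p z (Ioo_subset_Icc_self hz)) B := by
  obtain ⟨m, hm0, hm⟩ := exists_supergradient_of_isMaxOn hΓ hp fun q hq => hv ⟨q, hq⟩
  refine le_revA hσ hz fun w hw => (lt_or_ge _ 0).imp_right fun hadv => ?_
  have hle := (le_revB_postedPrice hσ hz hp.2).trans <| (hB _).trans <|
    revB_le hσ hD hz hm0 hm (fun q hq => hv ⟨q, hq⟩) hpz.le hw.le hadv
  have hp0 : 0 ≤ revenueCurve D p := mul_nonneg p.coe_nonneg (sub_nonneg.2 (cdf_le_one D p))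
  have hloss := (ENNReal.ofReal_le_ofReal_iff'.1 hle).resolve_right (hp0.trans_lt hpz).not_ge
  exact le_antisymm (nonpos_of_mul_nonpos_right (by linarith) (sub_pos.2 hpz)) (B.demand_mem _).1

theorem exists_delta_forall_isBestResponse (hσ : σ.IsOptimal) (hD : D (Iio 0) = 0)
    (hz : z ∈ Ioo (0 : ℝ) 1) (hΓ : ConcaveOn ℝ (Icc 0 (v : ℝ)) (revenueCurve D))
    (hv : ∀ q : ℝ≥0, revenueCurve D q ≤ revenueCurve D v) (hp : p ∈ Ioo 0 v)
    (hpz : ∀ q < p, revenueCurve D q < (1 - z) * revenueCurve D v) {ε : ℝ} (hε : 0 < ε) :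
    ∃ δ : ℝ, 0 < δ ∧ ∀ p' : ℝ≥0, (p : ℝ) - δ < p' → p' < p →
      (∃ B, IsBestResponse σ D (lottery p' z (Ioo_subset_Icc_self hz)) B) ∧
      ∀ B, IsBestResponse σ D (lottery p' z (Ioo_subset_Icc_self hz)) B →
        ENNReal.ofReal (z * revenueCurve D p - ε)
          ≤ revA σ D (lottery p' z (Ioo_subset_Icc_self hz)) B ∧
        ENNReal.ofReal ((1 - z) * revenueCurve D v - ε)
          ≤ revB σ D (lottery p' z (Ioo_subset_Icc_self hz)) B := by
  have hcont : Continuous fun q => z * revenueCurve D q :=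
    continuous_const.mul continuous_revenueCurve
  obtain ⟨δ, hδ, hclose⟩ := Metric.continuous_iff.1 hcont p ε hε
  refine ⟨min δ p, lt_min hδ hp.1, fun p' hδp' hp'p => ?_⟩
  have hp' : p' ∈ Ioo 0 v := by
    refine ⟨?_, hp'p.trans hp.2⟩
    exact_mod_cast (sub_nonneg.2 (min_le_right δ p)).trans_lt hδp'
  refine ⟨⟨_, isBestResponse_postedPrice hσ hD hz hΓ hv hp' (hpz p' hp'p).le⟩, fun B hB => ⟨?_, ?_⟩⟩
  · refine (ENNReal.ofReal_le_ofReal ?_).trans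
      (le_revA_of_isBestResponse hσ hD hz hΓ hv hp' (hpz p' hp'p) hB)
    have hdist : dist (p' : ℝ) p < δ := by
      rw [dist_comm, Real.dist_eq, abs_of_pos (sub_pos.2 (NNReal.coe_lt_coe.2 hp'p))]
      linarith [min_le_left δ p]
    linarith [(abs_lt.1 (hclose p' hdist)).1]
  · exact (ENNReal.ofReal_le_ofReal (sub_le_self _ hε.le)).trans
      ((le_revB_postedPrice hσ hz hp'.2).trans (hB _))

theorem le_revA_of_isStackelbergEquilibrium (hσ : σ.IsOptimal) (hD : D (Iio 0) = 0)
    (hz : z ∈ Ioo (0 : ℝ) 1) (hΓ : ConcaveOn ℝ (Icc 0 (v : ℝ)) (revenueCurve D))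
    (hv : ∀ q : ℝ≥0, revenueCurve D q ≤ revenueCurve D v) (hp : p ∈ Ioo 0 v)
    (hpz : ∀ q < p, revenueCurve D q < (1 - z) * revenueCurve D v) {A : Mechanism}
    {R : Mechanism → Mechanism} (hR : IsStackelbergEquilibrium σ D A R) :
    ENNReal.ofReal (z * revenueCurve D p) ≤ revA σ D A (R A) := by
  have hcont : Continuous fun q : ℝ≥0 => ENNReal.ofReal (z * revenueCurve D q) :=
    ENNReal.continuous_ofReal.comp
      (continuous_const.mul (continuous_revenueCurve.comp NNReal.continuous_coe))
  have : (𝓝[<] p).NeBot := nhdsLT_neBot_of_exists_lt ⟨0, hp.1⟩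
  refine le_of_tendsto (hcont.continuousWithinAt (s := Iio p)) ?_
  filter_upwards [Ioo_mem_nhdsLT hp.1] with q hq
  exact (le_revA_of_isBestResponse hσ hD hz hΓ hv ⟨hq.1, hq.2.trans hp.2⟩ (hpz q hq.2)
    (hR.1 _)).trans (hR.2 _)

end Responses

/-! ### Concavity of the revenue curve -/

theorem concaveOn_of_sub_eq_integral {f g : ℝ → ℝ} {a v : ℝ}
    (hfg : ∀ x y, f y - f x = ∫ t in x..y, g t)
    (hint : ∀ x y, IntervalIntegrable g volume x y) (hg : AntitoneOn g (Ico a v)) :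
    ConcaveOn ℝ (Icc a v) f := by
  refine concaveOn_of_slope_anti_adjacent (convex_Icc a v) fun {x y z} hx hz hxy hyz => ?_
  have hy : y ∈ Ico a v := ⟨hx.1.trans hxy.le, hyz.trans_le hz.2⟩
  have hright : f z - f y ≤ g y * (z - y) := by
    calc f z - f y ≤ ∫ _ in y..z, g y := by
          rw [hfg]
          exact intervalIntegral.integral_mono_on_of_le_Ioo hyz.le (hint y z)
            intervalIntegrable_const fun t ht =>
              hg hy ⟨hy.1.trans ht.1.le, ht.2.trans_le hz.2⟩ ht.1.le
      _ = g y * (z - y) := by rw [intervalIntegral.integral_const, smul_eq_mul, mul_comm]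
  have hleft : g y * (y - x) ≤ f y - f x := by
    calc g y * (y - x) = ∫ _ in x..y, g y := by
          rw [intervalIntegral.integral_const, smul_eq_mul, mul_comm]
      _ ≤ f y - f x := by
          rw [hfg]
          exact intervalIntegral.integral_mono_on_of_le_Ioo hxy.le intervalIntegrable_const
            (hint x y) fun t ht => hg ⟨hx.1.trans ht.1.le, ht.2.trans hy.2⟩ hy ht.2.le
  exact ((div_le_iff₀ (sub_pos.2 hyz)).2 hright).trans ((le_div_iff₀ (sub_pos.2 hxy)).2 hleft)

/-- The marginal revenue `1 - F(t) - t f(t)`, which is almost everywhere the derivative of the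
revenue curve at `t`. -/
noncomputable def marginalRevenue (D : Measure ℝ) (f : ℝ → ℝ) (t : ℝ) : ℝ :=
  1 - cdf D t - t * f t

namespace IsDensity

variable {D : Measure ℝ} {f : ℝ → ℝ}

theorem nullSingletonClass (hf : IsDensity D f) : NullSingletonClass D := by
  obtain ⟨-, -, rfl⟩ := hf
  exact ⟨fun _ => withDensity_absolutelyContinuous _ _ (measure_singleton _)⟩

theorem virtualValue_nonpos_iff (hf : IsDensity D f) {t : ℝ} :
    virtualValue D f t ≤ 0 ↔ 0 ≤ marginalRevenue D f t := by
  rw [virtualValue, marginalRevenue]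
  split_ifs with h
  · simp [h, cdf_le_one]
  · rw [EReal.coe_nonpos, sub_nonpos, sub_nonneg, le_div_iff₀ ((hf.2.1 t).lt_of_ne' h)]

theorem marginalRevenue_le_of_virtualValue_le (hf : IsDensity D f) {a b : ℝ} (ha : 0 ≤ a)
    (hab : a ≤ b) (hφ : virtualValue D f a ≤ virtualValue D f b)
    (hb : 0 ≤ marginalRevenue D f b) : marginalRevenue D f b ≤ marginalRevenue D f a := by
  have hcdf := monotone_cdf D hab
  rcases le_total (f a) (f b) with hfab | hfba
  · have := mul_le_mul hab hfab (hf.2.1 a) (ha.trans hab)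
    rw [marginalRevenue, marginalRevenue]
    linarith
  by_cases hfb : f b = 0
  · have hfa : f a = 0 := by
      by_contra h
      rw [virtualValue, virtualValue, if_neg h, if_pos hfb, le_bot_iff] at hφ
      exact EReal.coe_ne_bot _ hφ
    rw [marginalRevenue, marginalRevenue, hfa, hfb]
    linarith
  have hb0 : 0 < f b := (hf.2.1 b).lt_of_ne' hfb
  have ha0 : 0 < f a := hb0.trans_le hfba
  rw [virtualValue, virtualValue, if_neg ha0.ne', if_neg hfb, EReal.coe_le_coe_iff] at hφ
  have hdiv : ∀ t, f t ≠ 0 → marginalRevenue D f t = f t * -(t - (1 - cdf D t) / f t) :=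
    fun t ht => by rw [marginalRevenue]; field_simp; ring
  rw [hdiv b hfb] at hb ⊢
  rw [hdiv a ha0.ne']
  exact mul_le_mul hfba (neg_le_neg hφ) (nonneg_of_mul_nonneg_right hb hb0) ha0.le

variable [IsProbabilityMeasure D]

theorem integrable (hf : IsDensity D f) : Integrable f := by
  obtain ⟨hm, h0, hD⟩ := hf
  refine ⟨hm.aestronglyMeasurable, ?_⟩
  rw [hasFiniteIntegral_iff_ofReal (Eventually.of_forall h0), ← setLIntegral_univ,
    ← withDensity_apply _ MeasurableSet.univ, ← hD]
  exact measure_lt_top D univ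

theorem cdf_eq (hf : IsDensity D f) (a x : ℝ) : cdf D x = cdf D a + ∫ t in a..x, f t := by
  have hIic : ∀ y, cdf D y = ∫ t in Iic y, f t := fun y => by
    rw [integral_eq_lintegral_of_nonneg_ae (Eventually.of_forall hf.2.1)
      hf.1.aestronglyMeasurable, ← withDensity_apply _ measurableSet_Iic, ← hf.2.2, cdf_eq_real,
      measureReal_def]
  rw [hIic, hIic, ← intervalIntegral.integral_Iic_sub_Iic hf.integrable.integrableOn
    hf.integrable.integrableOn, add_sub_cancel]

theorem intervalIntegrable_marginalRevenue (hf : IsDensity D f) (a b : ℝ) :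
    IntervalIntegrable (marginalRevenue D f) volume a b :=
  have := hf.nullSingletonClass
  ((continuous_const.sub continuous_cdf).intervalIntegrable a b).sub
    (hf.integrable.intervalIntegrable.continuousOn_mul continuous_id.continuousOn)

theorem revenueCurve_sub (hf : IsDensity D f) (a b : ℝ) :
    revenueCurve D b - revenueCurve D a = ∫ t in a..b, marginalRevenue D f t := by
  have htail : (fun x => 1 - cdf D x) = fun x => 1 - cdf D a - ∫ t in a..x, f t :=
    funext fun x => by rw [hf.cdf_eq a x, sub_sub]
  have hac : AbsolutelyContinuousOnInterval (fun x => 1 - cdf D x) a b := by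
    rw [htail]
    exact (LipschitzWith.const (1 - cdf D a)).lipschitzOnWith.absolutelyContinuousOnInterval.fun_sub
      (hf.integrable.intervalIntegrable.absolutelyContinuousOnInterval_intervalIntegral (by simp))
  have hid : AbsolutelyContinuousOnInterval (fun x : ℝ => x) a b :=
    LipschitzWith.id.lipschitzOnWith.absolutelyContinuousOnInterval
  rw [revenueCurve, revenueCurve, ← hid.integral_deriv_mul_eq_sub hac]
  refine intervalIntegral.integral_congr_ae ?_
  filter_upwards [LocallyIntegrable.ae_hasDerivAt_integral hf.integrable.locallyIntegrable]
    with x hx _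
  have hderiv : HasDerivAt (fun x => 1 - cdf D x) (-f x) x := by
    rw [htail]
    exact (hx a).const_sub _
  rw [hderiv.deriv, deriv_id'', marginalRevenue]
  ring

variable {v : ℝ}

theorem marginalRevenue_nonneg (hf : IsDensity D f) (hreg : IsRegularDist D f)
    (hv : ∀ q, 0 ≤ q → revenueCurve D q ≤ revenueCurve D v) (hv1 : cdf D v < 1) {t : ℝ}
    (ht : t ∈ Ico 0 v) : 0 ≤ marginalRevenue D f t := by
  by_contra! hneg
  have hneg_on : ∀ u ∈ Ioo t v, marginalRevenue D f u < 0 := fun u hu => by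
    rw [← not_le, ← hf.virtualValue_nonpos_iff] at hneg ⊢
    exact fun h => hneg <| (hreg ⟨ht.1, (monotone_cdf D ht.2.le).trans_lt hv1⟩
      ⟨ht.1.trans hu.1.le, (monotone_cdf D hu.2.le).trans_lt hv1⟩ hu.1.le).trans h
  have hint : 0 < ∫ u in t..v, -marginalRevenue D f u :=
    intervalIntegral.intervalIntegral_pos_of_pos_on (hf.intervalIntegrable_marginalRevenue t v).neg
      (fun u hu => neg_pos.2 (hneg_on u hu)) ht.2
  rw [intervalIntegral.integral_neg, ← hf.revenueCurve_sub] at hint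
  linarith [hv t ht.1]

theorem antitoneOn_marginalRevenue (hf : IsDensity D f)
    (hreg : IsRegularDist D f ∨ IsDMRDist D f)
    (hv : ∀ q, 0 ≤ q → revenueCurve D q ≤ revenueCurve D v) (hv1 : cdf D v < 1) :
    AntitoneOn (marginalRevenue D f) (Ico 0 v) := by
  have hrange : ∀ t ∈ Ico 0 v, t ∈ valueRange D := fun t ht =>
    ⟨ht.1, (monotone_cdf D ht.2.le).trans_lt hv1⟩
  intro a ha b hb hab
  rcases hreg with hreg | hdmr
  · exact hf.marginalRevenue_le_of_virtualValue_le ha.1 hab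
      (hreg (hrange a ha) (hrange b hb) hab) (hf.marginalRevenue_nonneg hreg hv hv1 hb)
  · have := hdmr (hrange a ha) (hrange b hb) hab
    rw [marginalRevenue, marginalRevenue]
    linarith

theorem concaveOn_revenueCurve (hf : IsDensity D f) (hD : D (Iio 0) = 0)
    (hreg : IsRegularDist D f ∨ IsDMRDist D f) {v : ℝ≥0}
    (hv : ∀ q : ℝ≥0, revenueCurve D q ≤ revenueCurve D v) :
    ConcaveOn ℝ (Icc 0 (v : ℝ)) (revenueCurve D) := by
  have := hf.nullSingletonClass
  obtain ⟨s, hs⟩ := exists_revenueCurve_pos hD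
  have hv1 : cdf D v < 1 :=
    sub_pos.1 (pos_of_mul_pos_right (hs.trans_le (hv s)) v.coe_nonneg)
  exact concaveOn_of_sub_eq_integral hf.revenueCurve_sub hf.intervalIntegrable_marginalRevenue
    (hf.antitoneOn_marginalRevenue hreg (fun q hq => hv ⟨q, hq⟩) hv1)

end IsDensity

theorem exists_isLeast_eq {g : ℝ≥0 → ℝ} (hg : Continuous g) {c : ℝ} {v : ℝ≥0} (h0 : g 0 < c)
    (hv : c < g v) :
    ∃ p, IsLeast {q | q ≤ v ∧ g q = c} p ∧ p ∈ Ioo 0 v ∧ ∀ q < p, g q < c := by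
  have hivt : ∀ u, c ≤ g u → ∃ q ≤ u, g q = c := fun u hu => by
    obtain ⟨q, hq, hqc⟩ := intermediate_value_Icc zero_le hg.continuousOn ⟨h0.le, hu⟩
    exact ⟨q, hq.2, hqc⟩
  have hcompact : IsCompact {q | q ≤ v ∧ g q = c} :=
    (isCompact_Icc (a := 0) (b := v)).of_isClosed_subset
      (isClosed_Iic.inter (isClosed_eq hg continuous_const)) fun q hq => ⟨zero_le, hq.1⟩
  obtain ⟨p, hp⟩ := hcompact.exists_isLeast (hivt v hv.le)
  refine ⟨p, hp, ⟨pos_iff_ne_zero.2 ?_, hp.1.1.lt_of_ne ?_⟩, fun q hq => ?_⟩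
  · rintro rfl
    exact h0.ne hp.1.2
  · rintro rfl
    exact hv.ne' hp.1.2
  · by_contra! hcq
    obtain ⟨r, hrq, hr⟩ := hivt q hcq
    exact (hrq.trans_lt hq).not_ge (hp.2 ⟨(hrq.trans hq.le).trans hp.1.1, hr⟩)

theorem theorem3p1_general
    (D : Measure ℝ) [IsProbabilityMeasure D] [NullSingletonClass D] (hD : D (Iio 0) = 0)
    (v : ℝ≥0) (hv : ∀ q : ℝ≥0, revenueCurve D q ≤ revenueCurve D v)
    (hΓ : ConcaveOn ℝ (Icc 0 (v : ℝ)) (revenueCurve D))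
    (σ : BuyerRule) (hσ : σ.IsOptimal) (z : ℝ) (hz : z ∈ Ioo (0 : ℝ) 1) :
    monopolyRev D = ENNReal.ofReal (revenueCurve D v) ∧
    (∃ p : ℝ≥0,
      IsLeast {q : ℝ≥0 | q ≤ v ∧ revenueCurve D q = (1 - z) * revenueCurve D v} p ∧
      (∃ B : Mechanism,
        IsBestResponse σ D (lottery p z (Ioo_subset_Icc_self hz)) B ∧
        ENNReal.ofReal (z * ((1 - z) * revenueCurve D v))
          ≤ revA σ D (lottery p z (Ioo_subset_Icc_self hz)) B ∧
        ENNReal.ofReal ((1 - z) * revenueCurve D v)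
          ≤ revB σ D (lottery p z (Ioo_subset_Icc_self hz)) B) ∧
      (∀ ε : ℝ, 0 < ε → ∃ δ : ℝ, 0 < δ ∧ ∀ p' : ℝ≥0, (p : ℝ) - δ < p' → p' < p →
        (∃ B : Mechanism, IsBestResponse σ D (lottery p' z (Ioo_subset_Icc_self hz)) B) ∧
        ∀ B : Mechanism, IsBestResponse σ D (lottery p' z (Ioo_subset_Icc_self hz)) B →
          ENNReal.ofReal (z * ((1 - z) * revenueCurve D v) - ε)
            ≤ revA σ D (lottery p' z (Ioo_subset_Icc_self hz)) B ∧
          ENNReal.ofReal ((1 - z) * revenueCurve D v - ε)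
            ≤ revB σ D (lottery p' z (Ioo_subset_Icc_self hz)) B)) ∧
    ENNReal.ofReal (z * ((1 - z) * revenueCurve D v)) ≤ stackelbergRev σ D ∧
    (∀ (A : Mechanism) (R : Mechanism → Mechanism), IsStackelbergEquilibrium σ D A R →
      ENNReal.ofReal (z * ((1 - z) * revenueCurve D v)) ≤ revA σ D A (R A)) := by
  obtain ⟨s, hs⟩ := exists_revenueCurve_pos hD
  have hpos : 0 < revenueCurve D v := hs.trans_le (hv s)
  obtain ⟨p, hleast, hp, hlt⟩ := exists_isLeast_eq
    (g := fun q => revenueCurve D q) (c := (1 - z) * revenueCurve D v) (v := v)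
    (continuous_revenueCurve.comp NNReal.continuous_coe)
    (by simpa [revenueCurve] using mul_pos (sub_pos.2 hz.2) hpos)
    (mul_lt_of_lt_one_left hpos (sub_lt_self 1 hz.1))
  have hpz : revenueCurve D p = (1 - z) * revenueCurve D v := hleast.1.2
  have hbest := isBestResponse_postedPrice hσ hD hz hΓ hv hp hpz.le
  have hA : ENNReal.ofReal (z * revenueCurve D p) ≤ revA σ D _ (postedPrice v) := le_revA hσ hz
    fun w hw => bobAdvantage_postedPrice_neg_or_demand_eq_zero hz hp.2 hw
  have happrox := fun ε hε =>
    exists_delta_forall_isBestResponse (ε := ε) hσ hD hz hΓ hv hp hlt hε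
  have heq := fun A R hR =>
    le_revA_of_isStackelbergEquilibrium (A := A) (R := R) hσ hD hz hΓ hv hp hlt hR
  rw [hpz] at hA
  simp only [hpz] at happrox heq
  exact ⟨monopolyRev_eq_revenueCurve hD hv,
    ⟨p, hleast, ⟨_, hbest, hA, le_revB_postedPrice hσ hz hp.2⟩, happrox⟩,
    le_iSup₂_of_le _ _ (le_iSup_of_le hbest hA), heq⟩

theorem theorem3p1
    (D : Measure ℝ) [IsProbabilityMeasure D] (hD : D (Set.Iio 0) = 0)
    (f : ℝ → ℝ) (hf : IsDensity D f)
    (hreg : IsRegularDist D f ∨ IsDMRDist D f)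
    (v : ℝ≥0) (hv : ∀ z : ℝ≥0, revenueCurve D z ≤ revenueCurve D v)
    (σ : BuyerRule) (hσ : σ.IsOptimal) :
    monopolyRev D = ENNReal.ofReal (revenueCurve D v) ∧
    (∃ p : ℝ≥0,
      IsLeast {q : ℝ≥0 | q ≤ v ∧ revenueCurve D q = revenueCurve D v / 2} p ∧
      (∃ B : Mechanism,
        IsBestResponse σ D (lottery p (1 / 2) (by norm_num)) B ∧
        ENNReal.ofReal (revenueCurve D v / 4)
          ≤ revA σ D (lottery p (1 / 2) (by norm_num)) B ∧
        ENNReal.ofReal (revenueCurve D v / 2)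
          ≤ revB σ D (lottery p (1 / 2) (by norm_num)) B) ∧
      (∀ ε : ℝ, 0 < ε → ∃ δ : ℝ, 0 < δ ∧ ∀ p' : ℝ≥0, (p : ℝ) - δ < p' → p' < p →
        (∃ B : Mechanism, IsBestResponse σ D (lottery p' (1 / 2) (by norm_num)) B) ∧
        ∀ B : Mechanism, IsBestResponse σ D (lottery p' (1 / 2) (by norm_num)) B →
          ENNReal.ofReal (revenueCurve D v / 4 - ε)
            ≤ revA σ D (lottery p' (1 / 2) (by norm_num)) B ∧
          ENNReal.ofReal (revenueCurve D v / 2 - ε)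
            ≤ revB σ D (lottery p' (1 / 2) (by norm_num)) B)) ∧
    ENNReal.ofReal (revenueCurve D v / 4) ≤ stackelbergRev σ D ∧
    (∀ (A : Mechanism) (R : Mechanism → Mechanism), IsStackelbergEquilibrium σ D A R →
      ENNReal.ofReal (revenueCurve D v / 4) ≤ revA σ D A (R A)) := by
  have := hf.nullSingletonClass
  have hgen := theorem3p1_general D hD v hv (hf.concaveOn_revenueCurve hD hreg hv) σ hσ (1 / 2)
    (by norm_num)
  have hquarter : 1 / 2 * ((1 - 1 / 2) * revenueCurve D v) = revenueCurve D v / 4 := by ring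
  have hhalf : (1 - 1 / 2) * revenueCurve D v = revenueCurve D v / 2 := by ring
  rwa [hquarter, hhalf] at hgen
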